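/- Let $2^\omega$ be Cantor space with the uniform measure $\mu$. For a set $U$ of finite binary strings let $[U]$ be the set of all $X\in 2^\omega$ that have a prefix in $U$. A sequence $(\mathcal U_n)_{n\in\mathbb N}$ of open sets is uniformly c.e. if $\mathcal U_n=[W_n]$ for prefix-free sets $W_n$ of strings that are c.e. uniformly in $n$. A Martin-Löf test is a non-increasing uniformly c.e. sequence of open sets with $\mu(\mathcal U_n)\le 2^{-n}$ for all $n$; a Schnorr test is a Martin-Löf test with $\mu(\mathcal U_n)=2^{-n}$ for all $n$; a generalized Martin-Löf test is a uniformly c.e. sequence of open sets with $\lim_n\mu(\mathcal U_n)=0$. A sequence $X\in 2^\omega$ passes $(\mathcal U_n)_n$ if $X\notin\bigcap_n\mathcal U_n$. Let $\mathrm{MLR}$, $\mathrm{SR}$ and $\mathrm{W2R}$ (Martin-Löf random, Schnorr random and weakly 2-random sequences) be the sets of all $X$ that pass every Martin-Löf test, every Schnorr test and every generalized Martin-Löf test, respectively. A martingale is a function $d:2^{<\omega}\to\mathbb R^{\ge 0}$ with $d(\sigma)=\frac{d(\sigma 0)+d(\sigma 1)}{2}$ for all $\sigma$; it succeeds on $X$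 if $\limsup_n d(X\upharpoonright n)=\infty$. Let $\mathrm{CR}$ be the set of computably random sequences, i.e. of all $X$ on which no computable (real-valued) martingale succeeds. For $A\in 2^\omega$ and a class $\mathscr S$ among these, $\mathscr S^A$ is the class obtained by replacing "c.e." and "computable" by "c.e. in $A$" and "computable in $A$". Put $$\mathrm{Low}(\mathscr R)=\{A\in 2^\omega:\mathscr R^A=\mathscr R\},\qquad \mathrm{Low}(\mathscr R,\mathscr S)=\{A\in 2^\omega:\mathscr R\subseteq\mathscr S^A\}.$$ Then (i) $\mathrm{Low}(\mathrm{W2R},\mathrm{MLR})=\mathrm{Low}(\mathrm{MLR})$; (ii) $\mathrm{Low}(\mathrm{W2R},\mathrm{CR})=\mathrm{Low}(\mathrm{MLR},\mathrm{CR})$; (iii) $\mathrm{Low}(\mathrm{W2R},\mathrm{SR})=\mathrm{Low}(\mathrm{MLR},\mathrm{SR})$. -/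

import Mathlib

open Filter Topology MeasureTheory
open scoped NNReal ENNReal

namespace Randomness

/-- Cantor space `2^ω`. -/
abbrev Cantor : Type := ℕ → Bool

/-- Finite binary strings `2^{<ω}`. -/
abbrev Str : Type := List Bool

/-- The prefix `X(0) X(1) ⋯ X(n-1)` of `X` of length `n`. -/
def prefixOf (X : Cantor) (n : ℕ) : Str := (List.range n).map X

/-- The cylinder `[σ]` of all infinite sequences with prefix `σ`. -/
def cyl (σ : Str) : Set Cantor := {X | prefixOf X σ.length = σ}

/-- The open set `[U]` generated by a set `U` of strings. -/
def openGen (U : Set Str) : Set Cantor := ⋃ σ ∈ U, cyl σ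

/-- No element of `U` is a proper prefix of another element of `U`. -/
def PrefixFree (U : Set Str) : Prop := ∀ σ ∈ U, ∀ τ ∈ U, σ <+: τ → σ = τ

/-- The uniform (Lebesgue) measure on `2^ω`: the product of fair coin measures. -/
noncomputable def lebesgue : Measure Cantor :=
  Measure.infinitePi fun _ : ℕ => (PMF.uniformOfFintype Bool).toMeasure

/-- `A ∈ 2^ω` as an oracle. In everything below, notions are relativized to a set `O` of oracles;
`O = oracle A` is relativization to `A`, and `O = ∅` is the unrelativized notion. -/
def oracle (A : Cantor) : Set (ℕ →. ℕ) := {fun n => Part.some (A n).toNat}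

/-- `S` is c.e. relative to `O`: the domain of a partial function that is computable in `O`. -/
def CEIn {α : Type} [Primcodable α] (O : Set (ℕ →. ℕ)) (S : Set α) : Prop :=
  RecursiveIn O ((fun a => Part.assert (a ∈ S) fun _ => Part.some ()) : α →. Unit)

/-- `(𝒰 n)` is a sequence of uniformly c.e. open sets relative to `O`: the sets `𝒰 n` are
generated by prefix-free sets of strings that are c.e. in `O`, uniformly in `n`. -/
def UniformlyCEOpen (O : Set (ℕ →. ℕ)) (𝒰 : ℕ → Set Cantor) : Prop :=
  ∃ W : ℕ → Set Str, CEIn O {p : ℕ × Str | p.2 ∈ W p.1} ∧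
    (∀ n, PrefixFree (W n)) ∧ ∀ n, 𝒰 n = openGen (W n)

/-- Martin-Löf tests relative to `O`. -/
def IsMLTest (O : Set (ℕ →. ℕ)) (𝒰 : ℕ → Set Cantor) : Prop :=
  UniformlyCEOpen O 𝒰 ∧ Antitone 𝒰 ∧ ∀ n, lebesgue (𝒰 n) ≤ (2⁻¹ : ℝ≥0∞) ^ n

/-- Schnorr tests relative to `O`. -/
def IsSchnorrTest (O : Set (ℕ →. ℕ)) (𝒰 : ℕ → Set Cantor) : Prop :=
  UniformlyCEOpen O 𝒰 ∧ Antitone 𝒰 ∧ ∀ n, lebesgue (𝒰 n) = (2⁻¹ : ℝ≥0∞) ^ n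

/-- Generalized Martin-Löf tests relative to `O`. -/
def IsGenMLTest (O : Set (ℕ →. ℕ)) (𝒰 : ℕ → Set Cantor) : Prop :=
  UniformlyCEOpen O 𝒰 ∧ Tendsto (fun n => lebesgue (𝒰 n)) atTop (𝓝 0)

/-- Martingales `d : 2^{<ω} → ℝ^{≥ 0}`. -/
def IsMartingale (d : Str → ℝ≥0) : Prop :=
  ∀ σ, d σ = (d (σ ++ [false]) + d (σ ++ [true])) / 2

/-- `d` is computable in `O` as a real-valued function: a function computable in `O` maps `(σ, n)`
to the numerator of a dyadic rational `a / 2 ^ n` that approximates `d σ` up to `2 ^ (-n)`. -/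
def ComputableRealIn (O : Set (ℕ →. ℕ)) (d : Str → ℝ≥0) : Prop :=
  ∃ a : Str → ℕ → ℕ, ComputableIn₂ O a ∧
    ∀ σ n, |(d σ : ℝ) - (a σ n : ℝ) / 2 ^ n| ≤ (2⁻¹ : ℝ) ^ n

/-- The martingale `d` succeeds on `X`: `limsup d(X ↾ n) = ∞`. -/
def Succeeds (d : Str → ℝ≥0) (X : Cantor) : Prop :=
  limsup (fun n => (d (prefixOf X n) : ℝ≥0∞)) atTop = ⊤

/-- Martin-Löf random sequences, relative to `O`. -/
def MLR (O : Set (ℕ →. ℕ)) : Set Cantor := {X | ∀ 𝒰, IsMLTest O 𝒰 → X ∉ ⋂ n, 𝒰 n}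

/-- Schnorr random sequences, relative to `O`. -/
def SR (O : Set (ℕ →. ℕ)) : Set Cantor := {X | ∀ 𝒰, IsSchnorrTest O 𝒰 → X ∉ ⋂ n, 𝒰 n}

/-- Weakly 2-random sequences, relative to `O`. -/
def W2R (O : Set (ℕ →. ℕ)) : Set Cantor := {X | ∀ 𝒰, IsGenMLTest O 𝒰 → X ∉ ⋂ n, 𝒰 n}

/-- Computably random sequences, relative to `O`. -/
def CR (O : Set (ℕ →. ℕ)) : Set Cantor :=
  {X | ∀ d, IsMartingale d → ComputableRealIn O d → ¬ Succeeds d X}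

/-- `Low(ℛ)`: the oracles `A` with `ℛ^A = ℛ`. -/
def Low (R : Set (ℕ →. ℕ) → Set Cantor) : Set Cantor := {A | R (oracle A) = R ∅}

/-- `Low(ℛ, 𝒮)`: the oracles `A` with `ℛ ⊆ 𝒮^A`. -/
def LowPair (R S : Set (ℕ →. ℕ) → Set Cantor) : Set Cantor := {A | R ∅ ⊆ S (oracle A)}

end Randomness

/-! Every Martin-Löf test is a generalized one, so `W2R ∅ ⊆ MLR ∅` and one inclusion in each
equality is immediate; for (i) one also uses that more oracles give more tests. For the converse,
suppose a Martin-Löf random `Z` lies outside the relativized class `S`. It suffices to produce a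
weakly 2-random `Y` outside `S`.

The failure of `Z` is first made invariant under deleting initial segments: from a test or
martingale that `Z` fails one builds another of the same kind, relative to the same oracle, together
with open sets `G n` that contain the relevant tails of `Z` and whose common points fail the new
test or martingale (`spread`, `padded`, `mix`). A weakly 2-random point of `⋂ n, G n` is then found
by forcing with effectively closed sets of positive measure (`exists_mem_W2R`). To pass a
generalized test, remove a component of measure smaller than that of the current closed set. To
enter `G n`, use Kučera's theorem: some tail of `Z` lies in the closed set, hence in `G n`, so a
cylinder around it lies in `G n`; the closed set keeps positive measure inside this cylinder,
because a tail of a Martin-Löf random sequence avoids effectively closed null sets. Only the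
countably many unrelativized tests must be met, and compactness gives `Y`. The `G n` are merely
open, so no effectiveness relative to the oracle enters the forcing.

Schnorr tests need the exact measure `2⁻¹ ^ n`. The forcing is therefore confined to sequences that
begin with `true`, which leaves the other half of the space free for padding. -/

namespace Randomness

/-! ### Relative computability: closure properties and approximation in stages -/

section Computability

variable {α β γ σ : Type} [Primcodable α] [Primcodable β] [Primcodable γ] [Primcodable σ]
  {O : Set (ℕ →. ℕ)}

theorem _root_.ComputableIn.comp {f : β → σ} {g : α → β} (hf : ComputableIn O f)
    (hg : ComputableIn O g) : ComputableIn O fun a => f (g a) := by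
  refine Nat.RecursiveIn.of_eq (Nat.RecursiveIn.comp hf hg) fun n => ?_
  cases Encodable.decode (α := α) n <;> simp

theorem _root_.ComputableIn.pair {f : α → β} {g : α → γ} (hf : ComputableIn O f)
    (hg : ComputableIn O g) : ComputableIn O fun a => (f a, g a) := by
  refine Nat.RecursiveIn.of_eq (Nat.RecursiveIn.pair hf hg) fun n => ?_
  cases Encodable.decode (α := α) n <;> simp [Seq.seq]

theorem _root_.ComputableIn.of_eq {f g : α → σ} (hf : ComputableIn O f) (h : ∀ a, f a = g a) :
    ComputableIn O g := (funext h : f = g) ▸ hf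

theorem _root_.ComputableIn₂.comp {f : β → γ → σ} {g : α → β} {h : α → γ} (hf : ComputableIn₂ O f)
    (hg : ComputableIn O g) (hh : ComputableIn O h) : ComputableIn O fun a => f (g a) (h a) :=
  ComputableIn.comp (f := fun p : β × γ => f p.1 p.2) hf (hg.pair hh)

theorem _root_.ComputableIn.nat_rec {f : α → ℕ} {g : α → σ} {h : α → ℕ → σ → σ}
    (hf : ComputableIn O f) (hg : ComputableIn O g)
    (hh : ComputableIn O fun p : α × ℕ × σ => h p.1 p.2.1 p.2.2) :
    ComputableIn O fun a => (Nat.rec (g a) (fun y ih => h a y ih) (f a) : σ) := by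
  have hid : Nat.RecursiveIn O (fun n => Part.some n) :=
    (Nat.Partrec.some).recursiveIn
  refine Nat.RecursiveIn.of_eq
    (Nat.RecursiveIn.comp (Nat.RecursiveIn.prec hg hh) (Nat.RecursiveIn.pair hid hf)) fun n => ?_
  cases hn : Encodable.decode (α := α) n with
  | none => simp [Seq.seq]
  | some a =>
    simp only [Seq.seq, Part.coe_some, Part.bind_some, Part.map_some, Part.map_eq_map,
      Part.bind_eq_bind, Nat.unpair_pair, Encodable.encode_nat]
    induction f a with
    | zero => simp [hn]
    | succ k ih => simp only [ih]; simp [hn]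

/-- The list of values is built entry by entry with `ComputableIn.nat_rec`, the recursion variable
being the number of entries already treated. -/
theorem _root_.ComputableIn.list_map [Inhabited α] {g : α → β} (hg : ComputableIn O g) :
    ComputableIn O fun l : List α => l.map g := by
  have key : ∀ (l : List α) (n : ℕ), n ≤ l.length →
      (Nat.rec [] (fun y (ih : List β) => ih ++ [g (l.getD y default)]) n : List β)
        = (l.take n).map g := by
    intro l n
    induction n with
    | zero => simp
    | succ k ih =>
      intro hk
      have hk' : k < l.length := hk
      simp only [ih hk'.le]
      rw [← List.take_concat_get' l k hk', List.getD_eq_getElem _ _ hk']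
      simp only [List.map_append, List.map_cons, List.map_nil]
  refine (ComputableIn.nat_rec (f := List.length) (g := fun _ => ([] : List β))
    (h := fun l y ih => ih ++ [g (l.getD y default)]) Primrec.list_length.computableIn
    (ComputableIn.const _) ?_).of_eq fun l => by
      rw [key l l.length le_rfl, List.take_length]
  have h1 : ComputableIn O fun p : List α × ℕ × List β => g (p.1.getD p.2.1 default) :=
    hg.comp (Primrec.computableIn
      ((Primrec.list_getD default).comp Primrec.fst (Primrec.fst.comp Primrec.snd)))
  exact ComputableIn₂.comp (f := fun (l : List β) a => l ++ [a])
    Primrec.list_concat.computableIn₂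
    (Primrec.snd.comp Primrec.snd).computableIn h1

/-- A function that applies a primitive recursive map to finitely many values of `g`, the
arguments of which are found primitive recursively, is computable relative to whatever computes
`g`. -/
theorem _root_.ComputableIn.of_queries [Inhabited β] {g : β → γ} {q : α → List β}
    {h : α → List γ → σ} (hg : ComputableIn O g) (hq : Primrec q) (hh : Primrec₂ h) :
    ComputableIn O fun a => h a ((q a).map g) :=
  ComputableIn₂.comp hh.computableIn₂ (ComputableIn.id)
    (hg.list_map.comp hq.computableIn)

/-- Unbounded search for a zero of a function that ignores the search variable halts at once or
never. -/
theorem _root_.ComputableIn.ceIn {p : α → Bool} (hp : ComputableIn O p) :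
    CEIn O {a | p a = true} := by
  have hneg : ComputableIn O fun a => !p a :=
    ComputableIn.comp (f := fun b => !b) Primrec.not.computableIn hp
  have hz : Nat.RecursiveIn O (fun _ => Part.some 0) := (Nat.Partrec.of_primrec
    (Nat.Primrec.zero)).recursiveIn
  refine Nat.RecursiveIn.of_eq (Nat.RecursiveIn.comp hz (Nat.RecursiveIn.rfind
    (Nat.RecursiveIn.comp hneg Nat.RecursiveIn.left))) fun n => ?_
  cases hn : Encodable.decode (α := α) n with
  | none =>
    refine (Part.eq_none_iff.2 fun y hy => ?_).trans (by simp)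
    obtain ⟨m, hm, -⟩ := Part.mem_bind_iff.1 hy
    have := Nat.rfind_spec hm
    simp [hn] at this
  | some a =>
    ext y
    refine Part.mem_bind_iff.trans ?_
    cases hpa : p a
    · refine ⟨fun ⟨m, hm, _⟩ => ?_, fun h => ?_⟩
      · have := Nat.rfind_spec hm
        simp [hn, hpa] at this
      · simp [hpa] at h
    · refine ⟨fun ⟨m, hm, h⟩ => ?_, fun h => ⟨0, Nat.mem_rfind.2 ⟨?_, by simp⟩, ?_⟩⟩
      · have hy : y = 0 := by simpa [hpa] using h
        subst hy
        simpa [hpa] using ⟨(), rfl⟩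
      · simp [hn, hpa]
      · obtain ⟨u, hu⟩ : ∃ u : Unit, Encodable.encode u = y := by simpa [hpa] using h
        exact hu ▸ Part.mem_some 0

/-- `e (s, n)` is the value of the partial function `f` at `n`, as far as it is found within `s`
steps. -/
structure IsStaging (O : Set (ℕ →. ℕ)) (f : ℕ →. ℕ) (e : ℕ × ℕ → Option ℕ) : Prop where
  computable : ComputableIn O e
  mono : ∀ s t n y, s ≤ t → e (s, n) = some y → e (t, n) = some y
  mem_iff : ∀ n y, y ∈ f n ↔ ∃ s, e (s, n) = some y

end Computability

/-- Every partial function in `O` is total. -/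
def TotalOracles (O : Set (ℕ →. ℕ)) : Prop := ∀ g ∈ O, ∃ g' : ℕ → ℕ, g = fun n => Part.some (g' n)

/-- Induction on the derivation, with one stage bound shared by all subcomputations; monotonicity
merges different bounds. Since `e` itself may consult the oracle, a total oracle simply answers at
stage 0 and no finite use has to be tracked. -/
theorem exists_isStaging {O : Set (ℕ →. ℕ)} (hO : TotalOracles O) {f : ℕ →. ℕ}
    (hf : Nat.RecursiveIn O f) : ∃ e, IsStaging O f e := by
  induction hf with
  | zero => exact ⟨fun _ => some 0, .const _, by simp, fun n y => by
      refine Part.mem_some_iff.trans ?_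
      simp [eq_comm]⟩
  | succ =>
    exact ⟨fun p => some (p.2 + 1),
      (Primrec.option_some.comp (Primrec.succ.comp Primrec.snd)).computableIn,
      by simp, fun n y => by simp [eq_comm]⟩
  | left =>
    exact ⟨fun p => some p.2.unpair.1, (Primrec.option_some.comp (Primrec.fst.comp
      (Primrec.unpair.comp Primrec.snd))).computableIn, by simp, fun n y => by simp [eq_comm]⟩
  | right =>
    exact ⟨fun p => some p.2.unpair.2, (Primrec.option_some.comp (Primrec.snd.comp
      (Primrec.unpair.comp Primrec.snd))).computableIn, by simp, fun n y => by simp [eq_comm]⟩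
  | oracle g hg =>
    obtain ⟨g', rfl⟩ := hO g hg
    have : ComputableIn O g' := RecursiveIn.oracle _ hg
    exact ⟨fun p => some (g' p.2), ComputableIn.comp (f := some) Primrec.option_some.computableIn
      (this.comp (.snd)), by simp, fun n y => by simp [eq_comm]⟩
  | @pair f h _ _ ihf ihh =>
    obtain ⟨e₁, c₁, m₁, i₁⟩ := ihf
    obtain ⟨e₂, c₂, m₂, i₂⟩ := ihh
    refine ⟨fun p => (e₁ p).bind fun a => (e₂ p).map fun b => Nat.pair a b, ?_, ?_, ?_⟩
    · refine ComputableIn₂.comp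
        (f := fun o₁ o₂ : Option ℕ => o₁.bind fun a => o₂.map fun b => Nat.pair a b)
        (Primrec₂.computableIn₂ ?_) c₁ c₂
      exact Primrec.option_bind Primrec.fst (Primrec.option_map (Primrec.snd.comp Primrec.fst)
        (Primrec₂.natPair.comp (Primrec.snd.comp Primrec.fst) Primrec.snd).to₂).to₂
    · intro s t n y hst
      simp only [Option.bind_eq_some_iff, Option.map_eq_some_iff]
      rintro ⟨a, ha, b, hb, rfl⟩
      exact ⟨a, m₁ _ _ _ _ hst ha, b, m₂ _ _ _ _ hst hb, rfl⟩
    · intro n y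
      simp only [Option.bind_eq_some_iff, Option.map_eq_some_iff, Seq.seq, Part.map_eq_map,
        Part.mem_bind_iff, Part.mem_map_iff, i₁, i₂]
      constructor
      · rintro ⟨_, ⟨a, ⟨s, hs⟩, rfl⟩, b, ⟨t, ht⟩, rfl⟩
        exact ⟨max s t, a, m₁ _ _ _ _ (le_max_left _ _) hs, b,
          m₂ _ _ _ _ (le_max_right _ _) ht, rfl⟩
      · rintro ⟨s, a, ha, b, hb, rfl⟩
        exact ⟨_, ⟨a, ⟨s, ha⟩, rfl⟩, b, ⟨s, hb⟩, rfl⟩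
  | @comp f h _ _ ihf ihh =>
    obtain ⟨e₁, c₁, m₁, i₁⟩ := ihf
    obtain ⟨e₂, c₂, m₂, i₂⟩ := ihh
    refine ⟨fun p => (e₂ p).bind fun a => e₁ (p.1, a), ?_, ?_, ?_⟩
    -- While `e₂ p` is undefined, `e₁` is queried at the default 0 and the answer is discarded.
    · refine (ComputableIn₂.comp (f := fun o₁ o₂ : Option ℕ => o₁.bind fun _ => o₂)
        (g := e₂) (h := fun p => e₁ (p.1, (e₂ p).getD 0))
        (Primrec₂.computableIn₂ ?_) c₂ ?_).of_eq fun p => ?_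
      · exact Primrec.option_bind Primrec.fst (Primrec.snd.comp Primrec.fst).to₂
      · exact c₁.comp (ComputableIn.fst.pair (ComputableIn.comp (f := fun o : Option ℕ => o.getD 0)
          (Primrec.option_getD.comp Primrec.id (Primrec.const 0)).computableIn c₂))
      · cases h : e₂ p <;> simp
    · intro s t n y hst
      simp only [Option.bind_eq_some_iff]
      rintro ⟨a, ha, hb⟩
      exact ⟨a, m₂ _ _ _ _ hst ha, m₁ _ _ _ _ hst hb⟩
    · intro n y
      refine Part.mem_bind_iff.trans ?_
      simp only [Option.bind_eq_some_iff, i₁, i₂]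
      constructor
      · rintro ⟨a, ⟨s, hs⟩, t, ht⟩
        exact ⟨max s t, a, m₂ _ _ _ _ (le_max_left _ _) hs, m₁ _ _ _ _ (le_max_right _ _) ht⟩
      · rintro ⟨s, a, ha, hb⟩
        exact ⟨a, ⟨s, ha⟩, s, hb⟩
  | @prec f h _ _ ihf ihh =>
    obtain ⟨e₁, c₁, m₁, i₁⟩ := ihf
    obtain ⟨e₂, c₂, m₂, i₂⟩ := ihh
    have hmono : ∀ s t a n y, s ≤ t →
        (Nat.rec (e₁ (s, a)) (fun y ih => ih.bind fun i => e₂ (s, Nat.pair a (Nat.pair y i))) n :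
          Option ℕ) = some y →
        (Nat.rec (e₁ (t, a)) (fun y ih => ih.bind fun i => e₂ (t, Nat.pair a (Nat.pair y i))) n :
          Option ℕ) = some y := by
      intro s t a n y hst
      induction n generalizing y with
      | zero => exact m₁ _ _ _ _ hst
      | succ k ih =>
        simp only [Option.bind_eq_some_iff]
        rintro ⟨i, hi, hy⟩
        exact ⟨i, ih _ hi, m₂ _ _ _ _ hst hy⟩
    refine ⟨fun p => Nat.rec (e₁ (p.1, p.2.unpair.1)) (fun y ih => ih.bind fun i =>
      e₂ (p.1, Nat.pair p.2.unpair.1 (Nat.pair y i))) p.2.unpair.2, ?_, ?_, ?_⟩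
    · refine ComputableIn.nat_rec (f := fun p : ℕ × ℕ => p.2.unpair.2)
        (g := fun p : ℕ × ℕ => e₁ (p.1, p.2.unpair.1))
        (h := fun p y ih => ih.bind fun i => e₂ (p.1, Nat.pair p.2.unpair.1 (Nat.pair y i)))
        (Primrec.snd.comp (Primrec.unpair.comp Primrec.snd)).computableIn
        (c₁.comp (Primrec.fst.pair
          (Primrec.fst.comp (Primrec.unpair.comp Primrec.snd))).computableIn) ?_
      refine (ComputableIn₂.comp (f := fun o₁ o₂ : Option ℕ => o₁.bind fun _ => o₂)
        (g := fun q : (ℕ × ℕ) × ℕ × Option ℕ => q.2.2)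
        (h := fun q => e₂ (q.1.1, Nat.pair q.1.2.unpair.1 (Nat.pair q.2.1 (q.2.2.getD 0))))
        (Primrec₂.computableIn₂ ?_) ?_ ?_).of_eq fun p => ?_
      · exact Primrec.option_bind Primrec.fst (Primrec.snd.comp Primrec.fst).to₂
      · exact (Primrec.snd.comp Primrec.snd).computableIn
      · refine c₂.comp (Primrec.computableIn ?_)
        exact (Primrec.fst.comp Primrec.fst).pair (Primrec₂.natPair.comp (Primrec.fst.comp
          (Primrec.unpair.comp (Primrec.snd.comp Primrec.fst))) (Primrec₂.natPair.comp
            (Primrec.fst.comp Primrec.snd) (Primrec.option_getD.comp (Primrec.snd.comp Primrec.snd)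
              (Primrec.const 0))))
      · rcases p with ⟨p, y, _ | i⟩ <;> rfl
    · intro s t n y hst
      exact hmono s t _ _ y hst
    · intro p y
      simp only
      generalize p.unpair.1 = a
      generalize p.unpair.2 = n
      induction n generalizing y with
      | zero => exact i₁ a y
      | succ k ih =>
        refine Part.mem_bind_iff.trans ?_
        simp only [Option.bind_eq_some_iff, ih, i₂]
        constructor
        · rintro ⟨i, ⟨s, hs⟩, t, ht⟩
          exact ⟨max s t, i, hmono _ _ _ _ _ (le_max_left _ _) hs,
            m₂ _ _ _ _ (le_max_right _ _) ht⟩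
        · rintro ⟨s, i, ha, hb⟩
          exact ⟨i, ⟨s, ha⟩, s, hb⟩
  | @rfind f _ ih =>
    obtain ⟨e, c, m, i⟩ := ih
    -- At stage `s` the search sees the arguments below `s` only. It stops at the first value that
    -- is missing or zero, and has an answer only if that value is zero.
    let L : ℕ × ℕ → List (Option ℕ) := fun p =>
      ((List.range p.1).map fun k => (p.1, Nat.pair p.2 k)).map e
    let halts : Option ℕ → Bool := fun o => decide (o = none) || decide (o = some 0)
    let F : List (Option ℕ) → Option ℕ := fun l =>
      if l[l.findIdx halts]? = some (some 0) then some (l.findIdx halts) else none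
    have hF : ∀ p k, F (L p) = some k ↔ k < p.1 ∧ e (p.1, Nat.pair p.2 k) = some 0 ∧
        ∀ j < k, ∃ v, v ≠ 0 ∧ e (p.1, Nat.pair p.2 j) = some v := by
      intro p k
      have hlen : (L p).length = p.1 := by simp [L]
      have hget : ∀ j (hj : j < (L p).length), (L p)[j] = e (p.1, Nat.pair p.2 j) := by
        intro j hj; simp [L]
      constructor
      · intro h
        by_cases hc : (L p)[(L p).findIdx halts]? = some (some 0)
        · simp only [F, hc, if_true, Option.some.injEq] at h
          rw [h] at hc
          obtain ⟨hk, hk'⟩ := List.getElem?_eq_some_iff.1 hc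
          refine ⟨hlen ▸ hk, (hget _ _).symm.trans hk', fun j hj => ?_⟩
          have := List.not_of_lt_findIdx (p := halts) (xs := L p) (h ▸ hj)
          rw [hget] at this
          cases hv : e (p.1, Nat.pair p.2 j) with
          | none => simp [halts, hv] at this
          | some v => exact ⟨v, by simpa [halts, hv] using this, rfl⟩
        · simp [F, hc] at h
      · rintro ⟨hk, h0, hlt⟩
        have hk' : k < (L p).length := hlen.symm ▸ hk
        have hidx : (L p).findIdx halts = k := by
          rw [List.findIdx_eq hk']
          refine ⟨by rw [hget, h0]; simp [halts], fun j hj => ?_⟩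
          obtain ⟨v, hv, hev⟩ := hlt j hj
          rw [hget, hev]
          simp [halts, hv]
        simp only [F, hidx, List.getElem?_eq_getElem hk', hget, h0, if_true]
    have hhalts : Primrec halts := Primrec.or.comp
      (Primrec.eq.decide.comp Primrec.id (Primrec.const _))
      (Primrec.eq.decide.comp Primrec.id (Primrec.const _))
    have hidx : Primrec fun l : List (Option ℕ) => l.findIdx halts :=
      Primrec.list_findIdx Primrec.id (hhalts.comp Primrec.snd).to₂
    have hFp : Primrec F := Primrec.ite
      (Primrec.eq.comp (Primrec.list_getElem?.comp Primrec.id hidx) (Primrec.const _))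
      (Primrec.option_some.comp hidx) (Primrec.const _)
    refine ⟨fun p => F (L p), ?_, ?_, ?_⟩
    · refine ComputableIn.of_queries (h := fun _ l => F l) c ?_ (hFp.comp Primrec.snd).to₂
      exact Primrec.list_map (Primrec.list_range.comp Primrec.fst)
        ((Primrec.fst.comp Primrec.fst).pair
        (Primrec₂.natPair.comp (Primrec.snd.comp Primrec.fst) Primrec.snd)).to₂
    · intro s t n y hst
      rw [hF, hF]
      rintro ⟨h1, h2, h3⟩
      refine ⟨lt_of_lt_of_le h1 hst, m _ _ _ _ hst h2, fun j hj => ?_⟩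
      obtain ⟨v, hv, hj⟩ := h3 j hj
      exact ⟨v, hv, m _ _ _ _ hst hj⟩
    · intro n y
      have hmem : ∀ b k, b ∈ ((fun m => decide (m = 0)) <$> f (Nat.pair n k) : Part Bool) ↔
          ∃ v, (∃ s, e (s, Nat.pair n k) = some v) ∧ decide (v = 0) = b := fun b k =>
        (Part.mem_map_iff _).trans (by simp only [i])
      refine Nat.mem_rfind.trans ((and_congr (hmem _ _)
        (forall₂_congr fun _ _ => hmem _ _)).trans ?_)
      simp only [hF]
      constructor
      · rintro ⟨⟨v, ⟨s, hs⟩, hv⟩, hlt⟩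
        have hv0 : v = 0 := by simpa using hv
        subst hv0
        have : ∀ j, ∃ s', j < y → ∃ v, v ≠ 0 ∧ e (s', Nat.pair n j) = some v := by
          intro j
          by_cases hj : j < y
          · obtain ⟨v, ⟨s', hs'⟩, hv⟩ := hlt j hj
            exact ⟨s', fun _ => ⟨v, by simpa using hv, hs'⟩⟩
          · exact ⟨0, fun h => absurd h hj⟩
        choose S hS using this
        have hle : ∀ j < y, S j ≤ (Finset.range y).sup S := fun j hj =>
          Finset.le_sup (f := S) (Finset.mem_range.2 hj)
        -- The stage must exceed `y`, so that `y` is searched at all, and must bound the stages of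
        -- all values up to `y`.
        refine ⟨max (y + 1) (max s ((Finset.range y).sup S)), by omega,
          m _ _ _ _ (by omega) hs, fun j hj => ?_⟩
        obtain ⟨v, hv, h⟩ := hS j hj
        exact ⟨v, hv, m _ _ _ _ (by have := hle j hj; omega) h⟩
      · rintro ⟨s, h1, h2, h3⟩
        refine ⟨⟨0, ⟨s, h2⟩, by simp⟩, fun {j} hj => ?_⟩
        obtain ⟨v, hv, h⟩ := h3 j hj
        exact ⟨v, ⟨s, h⟩, by simpa using hv⟩

theorem totalOracles_empty : TotalOracles ∅ := fun _ h => h.elim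

theorem totalOracles_oracle (A : Cantor) : TotalOracles (oracle A) := by
  rintro g rfl
  exact ⟨fun n => (A n).toNat, rfl⟩

theorem CEIn.exists_stages {α : Type} [Primcodable α] {O : Set (ℕ →. ℕ)} (hO : TotalOracles O)
    {S : Set α} (hS : CEIn O S) : ∃ D : ℕ × α → Bool, ComputableIn O D ∧
      ∀ a, a ∈ S ↔ ∃ s, D (s, a) = true := by
  obtain ⟨e, hc, -, he⟩ := exists_isStaging hO hS
  refine ⟨fun p => (e (p.1, Encodable.encode p.2)).isSome,
    ComputableIn.comp (f := Option.isSome) Primrec.option_isSome.computableIn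
      (hc.comp (Primrec.fst.pair (Primrec.encode.comp Primrec.snd)).computableIn), fun a => ?_⟩
  have h1 : a ∈ S ↔ ∃ y, y ∈ ((Part.assert (a ∈ S) fun _ => Part.some ()) : Part Unit).map
      Encodable.encode := by simp
  rw [h1]
  have h2 := fun y => he (Encodable.encode a) y
  simp only [Encodable.encodek, Part.coe_some, Part.bind_some] at h2
  simp only [h2, Option.isSome_iff_exists]
  exact exists_comm

/-! ### C.e. open sets as hulls of decidable sets of strings -/

@[simp] theorem length_prefixOf (X : Cantor) (n : ℕ) : (prefixOf X n).length = n := by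
  simp [prefixOf]

theorem take_prefixOf (X : Cantor) {m n : ℕ} (h : m ≤ n) :
    (prefixOf X n).take m = prefixOf X m := by
  simp [prefixOf, ← List.map_take, List.take_range, h]

theorem prefixOf_prefix (X : Cantor) {m n : ℕ} (h : m ≤ n) : prefixOf X m <+: prefixOf X n :=
  take_prefixOf X h ▸ List.take_prefix _ _

/-- The set `c` of strings is closed under extension. -/
def Upward (c : Str → Bool) : Prop := ∀ σ τ, σ <+: τ → c σ = true → c τ = true

/-- The open set generated by a decidable set of strings. -/
def hull (c : Str → Bool) : Set Cantor := {X | ∃ m, c (prefixOf X m) = true}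

theorem mem_openGen {U : Set Str} {X : Cantor} : X ∈ openGen U ↔ ∃ m, prefixOf X m ∈ U := by
  simp only [openGen, cyl, Set.mem_iUnion, exists_prop]
  constructor
  · rintro ⟨σ, hσ, hX⟩
    exact ⟨σ.length, hX.symm ▸ hσ⟩
  · rintro ⟨m, hm⟩
    exact ⟨_, hm, by simp⟩

/-- A family of sets of strings that are closed under extension and uniformly computable in `O`. -/
structure IsDecFamily (O : Set (ℕ →. ℕ)) (C : ℕ → Str → Bool) : Prop where
  computable : ComputableIn₂ O C
  upward : ∀ n, Upward (C n)

theorem _root_.Primrec.list_any_id : Primrec fun l : List Bool => l.any id := by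
  have : PrimrecPred fun l : List Bool => ∃ a ∈ l, a = true :=
    PrimrecPred.exists_mem_list (Primrec.eq.comp Primrec.id (Primrec.const true))
  refine this.decide.of_eq fun l => ?_
  rw [Bool.eq_iff_iff]
  simp

/-- The queries by which `exists_isDecFamily` decides membership in its `n`-th set. -/
def relQueries (p : ℕ × Str) : List ((ℕ × Str) × ℕ) :=
  (List.range (p.2.length + 1)).map fun t => ((p.1, p.2.take t.unpair.1), t.unpair.2)

theorem primrec_relQueries : Primrec relQueries := by
  have hf : Primrec fun p : ℕ × Str => List.range (p.2.length + 1) :=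
    Primrec.list_range.comp (Primrec.succ.comp (Primrec.list_length.comp Primrec.snd))
  have hu : Primrec fun q : (ℕ × Str) × ℕ => q.2.unpair := Primrec.unpair.comp Primrec.snd
  have hg : Primrec fun q : (ℕ × Str) × ℕ =>
      ((q.1.1, q.1.2.take q.2.unpair.1), q.2.unpair.2) :=
    ((Primrec.fst.comp Primrec.fst).pair (Primrec.list_take.comp (Primrec.fst.comp hu)
      (Primrec.snd.comp Primrec.fst))).pair (Primrec.snd.comp hu)
  exact Primrec.list_map hf hg.to₂

/-- A string is admitted once one of its prefixes has a witness and the code of the pair (prefix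
length, witness) is at most the length of the string. This makes an existential condition decidable
and closed under extension, without changing the open set. -/
theorem exists_isDecFamily {O : Set (ℕ →. ℕ)} {R : (ℕ × Str) × ℕ → Bool} (hR : ComputableIn O R) :
    ∃ C, IsDecFamily O C ∧ ∀ n, hull (C n) = {X | ∃ m b, R ((n, prefixOf X m), b) = true} := by
  refine ⟨fun n τ => ((relQueries (n, τ)).map R).any id, ⟨?_, ?_⟩, ?_⟩
  · exact ComputableIn.of_queries hR primrec_relQueries
      (h := fun _ l => l.any id) (Primrec.list_any_id.comp Primrec.snd).to₂
  · intro n σ τ hστ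
    simp only [relQueries, List.any_map, List.any_eq_true, List.mem_range, Function.comp, id]
    rintro ⟨t, ht, h⟩
    have hle := hστ.length_le
    refine ⟨t, by omega, ?_⟩
    have h1 : t.unpair.1 ≤ σ.length := (Nat.unpair_left_le t).trans (by omega)
    obtain ⟨r, rfl⟩ := hστ
    rwa [List.take_append_of_le_length h1]
  · intro n
    ext X
    simp only [hull, relQueries, List.any_map, List.any_eq_true, List.mem_range, Function.comp, id,
      length_prefixOf, Set.mem_ofPred_eq]
    constructor
    · rintro ⟨m, t, ht, h⟩
      rw [take_prefixOf X ((Nat.unpair_left_le t).trans (by omega))] at h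
      exact ⟨_, _, h⟩
    · rintro ⟨m, b, h⟩
      refine ⟨Nat.pair m b, Nat.pair m b, by omega, ?_⟩
      rwa [Nat.unpair_pair, take_prefixOf X (Nat.left_le_pair m b)]

theorem UniformlyCEOpen.exists_isDecFamily {O : Set (ℕ →. ℕ)} (hO : TotalOracles O)
    {𝒰 : ℕ → Set Cantor} (h : UniformlyCEOpen O 𝒰) :
    ∃ C, IsDecFamily O C ∧ ∀ n, 𝒰 n = hull (C n) := by
  obtain ⟨W, hW, -, h𝒰⟩ := h
  obtain ⟨D, hD, hWD⟩ := hW.exists_stages hO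
  obtain ⟨C, hC, hCR⟩ := Randomness.exists_isDecFamily (R := fun p => D (p.2, p.1))
    (hD.comp (ComputableIn.snd.pair ComputableIn.fst))
  refine ⟨C, hC, fun n => ?_⟩
  rw [hCR, h𝒰]
  ext X
  rw [mem_openGen]
  exact exists_congr fun m => hWD (n, prefixOf X m)

/-- The minimal elements of the set of strings `c`, if `c` is closed under extension. -/
def minimal (c : Str → Bool) (τ : Str) : Bool := c τ && (decide (τ = []) || !c τ.dropLast)

theorem prefixFree_minimal {c : Str → Bool} (hc : Upward c) :
    PrefixFree {τ | minimal c τ = true} := by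
  intro σ hσ τ hτ hστ
  simp only [minimal, Set.mem_ofPred_eq, Bool.and_eq_true, Bool.or_eq_true, decide_eq_true_eq,
    Bool.not_eq_true'] at hσ hτ
  by_contra hne
  rcases hτ.2 with rfl | h
  · exact hne (List.prefix_nil.1 hστ)
  · have hlen : σ.length < τ.length := lt_of_le_of_ne hστ.length_le
      fun he => hne (hστ.eq_of_length he)
    have : σ <+: τ.dropLast := List.prefix_of_prefix_length_le hστ (List.dropLast_prefix τ)
      (by simp; omega)
    rw [hc _ _ this hσ.1] at h
    cases h

/-- The shortest prefix of `X` in `c` is minimal: this turns a hull back into an open set with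
prefix-free generators. -/
theorem openGen_minimal {c : Str → Bool} : openGen {τ | minimal c τ = true} = hull c := by
  ext X
  rw [mem_openGen]
  constructor
  · rintro ⟨m, hm⟩
    simp only [minimal, Set.mem_ofPred_eq, Bool.and_eq_true] at hm
    exact ⟨m, hm.1⟩
  · rintro hX
    classical
    have hX' : ∃ m, c (prefixOf X m) = true := hX
    refine ⟨Nat.find hX', ?_⟩
    simp only [minimal, Set.mem_ofPred_eq, Bool.and_eq_true, Bool.or_eq_true, decide_eq_true_eq,
      Bool.not_eq_true']
    refine ⟨Nat.find_spec hX', ?_⟩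
    rcases hk : Nat.find hX' with _ | k
    · left; simp [prefixOf]
    · right
      have h1 : (prefixOf X (k + 1)).dropLast = prefixOf X k := by
        rw [List.dropLast_eq_take, length_prefixOf, Nat.add_sub_cancel, take_prefixOf X k.le_succ]
      rw [h1]
      simpa using Nat.find_min hX' (m := k) (by omega)

theorem _root_.Primrec.list_dropLast {α : Type} [Primcodable α] :
    Primrec (List.dropLast : List α → List α) :=
  (Primrec.list_take.comp (Primrec.nat_sub.comp Primrec.list_length (Primrec.const 1))
    Primrec.id).of_eq fun _ => (List.dropLast_eq_take).symm

theorem IsDecFamily.computableIn_minimal {O : Set (ℕ →. ℕ)} {C : ℕ → Str → Bool}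
    (hC : IsDecFamily O C) : ComputableIn O fun p : ℕ × Str => minimal (C p.1) p.2 := by
  have h1 : ComputableIn O fun p : ℕ × Str => C p.1 p.2 := hC.computable
  have h2 : ComputableIn O fun p : ℕ × Str => C p.1 p.2.dropLast :=
    h1.comp (Primrec.fst.pair (Primrec.list_dropLast.comp Primrec.snd)).computableIn
  have h3 : ComputableIn O fun p : ℕ × Str => decide (p.2 = []) :=
    (Primrec.eq.decide.comp Primrec.snd (Primrec.const [])).computableIn
  have h4 : ComputableIn O fun p : ℕ × Str => decide (p.2 = []) || !C p.1 p.2.dropLast :=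
    ComputableIn₂.comp Primrec.or.computableIn₂ h3
      (ComputableIn.comp Primrec.not.computableIn h2)
  have h5 := ComputableIn₂.comp Primrec.and.computableIn₂ h1 h4
  exact h5

theorem IsDecFamily.uniformlyCEOpen {O : Set (ℕ →. ℕ)} {C : ℕ → Str → Bool}
    (hC : IsDecFamily O C) : UniformlyCEOpen O fun n => hull (C n) :=
  ⟨fun n => {τ | minimal (C n) τ = true}, hC.computableIn_minimal.ceIn,
    fun n => prefixFree_minimal (hC.upward n), fun _ => openGen_minimal.symm⟩

theorem uniformlyCEOpen_of_rel {O : Set (ℕ →. ℕ)} {𝒰 : ℕ → Set Cantor}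
    {R : (ℕ × Str) × ℕ → Bool} (hR : ComputableIn O R)
    (h : ∀ n X, X ∈ 𝒰 n ↔ ∃ m b, R ((n, prefixOf X m), b) = true) : UniformlyCEOpen O 𝒰 := by
  obtain ⟨C, hC, hCR⟩ := exists_isDecFamily hR
  have : 𝒰 = fun n => hull (C n) := by
    ext n X
    rw [hCR, h]
    rfl
  exact this ▸ hC.uniformlyCEOpen

/-- Without oracles, each computable function is determined by a code for a partial recursive
function. -/
theorem countable_computableIn_empty {α σ : Type} [Primcodable α] [Primcodable σ] :
    {f : α → σ | ComputableIn ∅ f}.Countable := by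
  let F : (α → σ) → (ℕ →. ℕ) := fun f n =>
    Part.bind (Encodable.decode (α := α) n) fun a => (Part.some (f a)).map Encodable.encode
  have hF : Function.Injective F := by
    intro f g hfg
    funext a
    have := congrFun hfg (Encodable.encode a)
    simpa [F] using this
  have hr : (Set.range Nat.Partrec.Code.eval).Countable := Set.countable_range _
  refine Set.MapsTo.countable_of_injOn (t := Set.range Nat.Partrec.Code.eval) (f := F)
    (fun f hf => ?_) hF.injOn hr
  obtain ⟨c, hc⟩ := Nat.Partrec.Code.exists_code.1 (recursiveIn_empty_iff.1 hf)
  exact ⟨c, hc⟩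

theorem countable_uniformlyCEOpen_empty : {𝒰 | UniformlyCEOpen ∅ 𝒰}.Countable := by
  refine ((countable_computableIn_empty (α := ℕ × Str) (σ := Bool)).image
    fun f n => hull fun τ => f (n, τ)).mono ?_
  intro 𝒰 h
  obtain ⟨C, hC, h𝒰⟩ := h.exists_isDecFamily totalOracles_empty
  exact ⟨fun p => C p.1 p.2, hC.computable, by ext n X; rw [h𝒰]⟩

/-! ### Prepending strings, deleting initial segments, and clopen sets -/

/-- The sequence `b X(0) X(1) ⋯`. -/
def cons (b : Bool) (X : Cantor) : Cantor
  | 0 => b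
  | n + 1 => X n

/-- The sequence `X(k) X(k+1) ⋯`. -/
def shift (k : ℕ) (X : Cantor) : Cantor := fun n => X (n + k)

/-- The sequence `ρ X(0) X(1) ⋯`. -/
def app (ρ : Str) (X : Cantor) : Cantor := ρ.foldr cons X

@[simp] theorem prefixOf_zero (X : Cantor) : prefixOf X 0 = [] := rfl

theorem prefixOf_cons (b : Bool) (X : Cantor) (m : ℕ) :
    prefixOf (cons b X) (m + 1) = b :: prefixOf X m := by
  simp only [prefixOf, List.range_succ_eq_map, List.map_cons, List.map_map]
  rfl

theorem prefixOf_app (ρ : Str) (X : Cantor) (m : ℕ) :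
    prefixOf (app ρ X) (ρ.length + m) = ρ ++ prefixOf X m := by
  induction ρ with
  | nil => simp [app]
  | cons b ρ ih =>
    have : (b :: ρ).length + m = (ρ.length + m) + 1 := by simp; omega
    rw [this]
    change prefixOf (cons b (app ρ X)) _ = _
    rw [prefixOf_cons, ih]
    rfl

theorem cons_shift_one (X : Cantor) : cons (X 0) (shift 1 X) = X := by
  funext n
  cases n <;> rfl

theorem shift_shift (k l : ℕ) (X : Cantor) : shift k (shift l X) = shift (k + l) X := by
  funext n
  simp [shift, add_assoc]

theorem app_prefixOf_shift (k : ℕ) (X : Cantor) : app (prefixOf X k) (shift k X) = X := by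
  induction k generalizing X with
  | zero => rfl
  | succ k ih =>
    have h1 : prefixOf X (k + 1) = X 0 :: prefixOf (shift 1 X) k := by
      conv_lhs => rw [← cons_shift_one X]
      exact prefixOf_cons _ _ _
    rw [h1]
    change cons (X 0) (app (prefixOf (shift 1 X) k) (shift (k + 1) X)) = X
    rw [← shift_shift k 1, ih, cons_shift_one]

theorem continuous_cons (b : Bool) : Continuous (cons b) :=
  continuous_pi fun n => by
    cases n with
    | zero => exact continuous_const
    | succ n => exact continuous_apply n

theorem continuous_shift (k : ℕ) : Continuous (shift k) :=
  continuous_pi fun n => continuous_apply (n + k)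

theorem continuous_app (ρ : Str) : Continuous (app ρ) := by
  induction ρ with
  | nil => exact continuous_id
  | cons b ρ ih => exact (continuous_cons b).comp ih

theorem isClopen_prefixOf (S : Set Str) (n : ℕ) : IsClopen {X | prefixOf X n ∈ S} := by
  have h : {X | prefixOf X n ∈ S} =
      (fun (X : Cantor) (i : Fin n) => X i) ⁻¹' {v | List.ofFn v ∈ S} := by
    ext X
    have : prefixOf X n = List.ofFn fun i : Fin n => X i := by
      refine List.ext_getElem (by simp) fun i _ _ => by simp [prefixOf]
    simp [this]
  rw [h]
  exact (isClopen_discrete _).preimage (continuous_pi fun i => continuous_apply _)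

theorem isOpen_hull (c : Str → Bool) : IsOpen (hull c) := by
  have : hull c = ⋃ m, {X | prefixOf X m ∈ {τ | c τ = true}} := by ext; simp [hull]
  rw [this]
  exact isOpen_iUnion fun m => (isClopen_prefixOf _ m).isOpen

theorem measurableSet_hull (c : Str → Bool) : MeasurableSet (hull c) :=
  (isOpen_hull c).measurableSet

theorem measurableSet_prefixOf (c : Str → Bool) (m : ℕ) :
    MeasurableSet {X | c (prefixOf X m) = true} :=
  (isClopen_prefixOf {τ | c τ = true} m).isOpen.measurableSet

/-! ### The uniform measure -/

instance : IsProbabilityMeasure lebesgue := by unfold lebesgue; infer_instance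

theorem coin_apply (T : Set Bool) : (PMF.uniformOfFintype Bool).toMeasure T =
    2⁻¹ * (T.indicator 1 false + T.indicator 1 true) := by
  rw [PMF.toMeasure_apply _ (MeasurableSet.of_discrete), tsum_bool]
  by_cases h1 : false ∈ T <;> by_cases h2 : true ∈ T <;> simp [h1, h2, mul_add]

/-- The right-hand side is a measure that agrees with the product measure on boxes. All later
measure computations on strings are inductions based on this splitting at the first bit. -/
theorem lebesgue_eq_cons {S : Set Cantor} (hS : MeasurableSet S) :
    lebesgue S = 2⁻¹ * (lebesgue (cons false ⁻¹' S) + lebesgue (cons true ⁻¹' S)) := by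
  have hm := fun b => (continuous_cons b).measurable
  suffices h : (2⁻¹ : ℝ≥0∞) • (lebesgue.map (cons false) + lebesgue.map (cons true)) = lebesgue by
    conv_lhs => rw [← h]
    simp [Measure.map_apply (hm _) hS, mul_add]
  refine Measure.eq_infinitePi _ fun s t ht => ?_
  classical
  obtain ⟨N, hN⟩ : ∃ N, s ⊆ Finset.range N := s.exists_nat_subset_range
  -- Adding trivial sides gives a box over an initial segment that includes coordinate 0, which can
  -- then be split off.
  let t' : ℕ → Set Bool := fun i => if i ∈ s then t i else Set.univ
  have hbox : Set.pi (s : Set ℕ) t = Set.pi (Finset.range (N + 1) : Set ℕ) t' := by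
    ext X
    simp only [Set.mem_pi, Finset.mem_coe, t']
    refine ⟨fun h i _ => ?_, fun h i hi => ?_⟩
    · by_cases hi : i ∈ s
      · simpa [hi] using h i hi
      · simp [hi]
    · have := h i (Finset.range_mono N.le_succ (hN hi))
      simpa [hi] using this
  have hprod : ∏ i ∈ s, (PMF.uniformOfFintype Bool).toMeasure (t i) =
      ∏ i ∈ Finset.range (N + 1), (PMF.uniformOfFintype Bool).toMeasure (t' i) := by
    rw [← Finset.prod_subset (hN.trans (Finset.range_mono N.le_succ))]
    · exact Finset.prod_congr rfl fun i hi => by simp [t', hi]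
    · intro i _ hi
      simp only [t', hi, if_false, measure_univ]
  have hpre : ∀ b, lebesgue (cons b ⁻¹' Set.pi (Finset.range (N + 1) : Set ℕ) t') =
      (t' 0).indicator 1 b * ∏ i ∈ Finset.range N,
        (PMF.uniformOfFintype Bool).toMeasure (t' (i + 1)) := by
    intro b
    have : cons b ⁻¹' Set.pi (Finset.range (N + 1) : Set ℕ) t' =
        {X | b ∈ t' 0 ∧ X ∈ Set.pi (Finset.range N : Set ℕ) fun i => t' (i + 1)} := by
      ext X
      simp only [Set.mem_preimage, Set.mem_pi, Finset.coe_range, Set.mem_Iio, Set.mem_ofPred_eq]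
      refine ⟨fun h => ⟨h 0 (by omega), fun i hi => h (i + 1) (by omega)⟩, fun h i hi => ?_⟩
      cases i with
      | zero => exact h.1
      | succ i => exact h.2 i (by omega)
    rw [this]
    by_cases hb : b ∈ t' 0
    · simp only [hb, true_and, Set.indicator_of_mem, Pi.one_apply, one_mul]
      exact Measure.infinitePi_pi _ fun _ _ => .of_discrete
    · simp [hb]
  have hmeas : MeasurableSet (Set.pi (Finset.range (N + 1) : Set ℕ) t') :=
    MeasurableSet.pi (Finset.countable_toSet _) fun _ _ => .of_discrete
  rw [hbox, hprod, Finset.prod_range_succ', coin_apply (t' 0)]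
  simp only [Measure.smul_apply, Measure.add_apply, Measure.map_apply (hm _) hmeas, hpre,
    smul_eq_mul]
  ring

theorem lebesgue_app_preimage_le (ρ : Str) {S : Set Cantor} (hS : MeasurableSet S) :
    lebesgue (app ρ ⁻¹' S) ≤ 2 ^ ρ.length * lebesgue S := by
  induction ρ generalizing S with
  | nil =>
    have : app [] ⁻¹' S = S := rfl
    simp [this]
  | cons b ρ ih =>
    have h1 : app (b :: ρ) ⁻¹' S = app ρ ⁻¹' (cons b ⁻¹' S) := rfl
    have h2 : lebesgue (cons b ⁻¹' S) ≤ 2 * lebesgue S := by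
      rw [lebesgue_eq_cons hS, ← mul_assoc, ENNReal.mul_inv_cancel (by simp) (by simp), one_mul]
      cases b
      · exact le_self_add
      · exact le_add_self
    calc lebesgue (app (b :: ρ) ⁻¹' S) ≤ 2 ^ ρ.length * lebesgue (cons b ⁻¹' S) :=
          h1 ▸ ih ((continuous_cons b).measurable hS)
      _ ≤ 2 ^ ρ.length * (2 * lebesgue S) := by gcongr
      _ = _ := by rw [List.length_cons, pow_succ, mul_assoc]

/-- The set of all `w X` with `X ∈ S`. -/
def glue (w : Str) (S : Set Cantor) : Set Cantor :=
  {X | prefixOf X w.length = w ∧ shift w.length X ∈ S}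

theorem measurableSet_glue (w : Str) {S : Set Cantor} (hS : MeasurableSet S) :
    MeasurableSet (glue w S) :=
  (isClopen_prefixOf {w} w.length).isOpen.measurableSet.inter ((continuous_shift _).measurable hS)

theorem lebesgue_glue (w : Str) {S : Set Cantor} (hS : MeasurableSet S) :
    lebesgue (glue w S) = 2⁻¹ ^ w.length * lebesgue S := by
  induction w with
  | nil =>
    have : glue [] S = S := by ext X; simp [glue]; rfl
    simp [this]
  | cons b w ih =>
    have h : ∀ b', cons b' ⁻¹' glue (b :: w) S = if b' = b then glue w S else ∅ := by
      intro b'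
      ext X
      have h1 : shift (w.length + 1) (cons b X) = shift w.length X := rfl
      by_cases hb : b' = b <;> simp [glue, prefixOf_cons, hb, h1]
    rw [lebesgue_eq_cons (measurableSet_glue _ hS), h, h]
    cases b <;> simp [ih, pow_succ'] <;> ring

theorem lebesgue_cyl (w : Str) : lebesgue (cyl w) = 2⁻¹ ^ w.length := by
  have : cyl w = glue w Set.univ := by ext; simp [cyl, glue]
  rw [this, lebesgue_glue w .univ, measure_univ, mul_one]

/-- The list of all strings of length `m`. -/
def strs : ℕ → List Str
  | 0 => [[]]
  | m + 1 => (strs m).map (List.cons false) ++ (strs m).map (List.cons true)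

/-- The number of strings of length `m` in `c`. -/
def cnt (c : Str → Bool) (m : ℕ) : ℕ := ((strs m).map c).count true

theorem cnt_succ (c : Str → Bool) (m : ℕ) : cnt c (m + 1) =
    cnt (fun τ => c (false :: τ)) m + cnt (fun τ => c (true :: τ)) m := by
  simp only [cnt, strs, List.map_append, List.map_map, List.count_append]
  rfl

theorem lebesgue_prefixOf (c : Str → Bool) (m : ℕ) :
    lebesgue {X | c (prefixOf X m) = true} = 2⁻¹ ^ m * cnt c m := by
  induction m generalizing c with
  | zero =>
    by_cases h : c [] = true <;> simp [cnt, strs, h]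
  | succ m ih =>
    rw [lebesgue_eq_cons (measurableSet_prefixOf c _)]
    have h : ∀ b, cons b ⁻¹' {X | c (prefixOf X (m + 1)) = true} =
        {X | c (b :: prefixOf X m) = true} := by
      intro b
      ext X
      simp [prefixOf_cons]
    rw [h, h, ih fun τ => c (false :: τ), ih fun τ => c (true :: τ), cnt_succ]
    push_cast
    ring

theorem mem_prefixOf_mono {c : Str → Bool} (hc : Upward c) {m n : ℕ} (h : m ≤ n) {X : Cantor}
    (hX : c (prefixOf X m) = true) : c (prefixOf X n) = true :=
  hc _ _ (prefixOf_prefix X h) hX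

theorem tendsto_lebesgue_hull {c : Str → Bool} (hc : Upward c) :
    Tendsto (fun m => lebesgue {X | c (prefixOf X m) = true}) atTop (𝓝 (lebesgue (hull c))) := by
  have : hull c = ⋃ m, {X | c (prefixOf X m) = true} := by ext; simp [hull]
  rw [this]
  exact tendsto_measure_iUnion_atTop fun m n h X hX => mem_prefixOf_mono hc h hX

/-! ### Computable counting and dyadic arithmetic -/

theorem primrec_strs : Primrec strs := by
  have hc : ∀ b, Primrec fun l : List Str => l.map (List.cons b) := fun b =>
    Primrec.list_map Primrec.id (Primrec.list_cons.comp (Primrec.const b) Primrec.snd).to₂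
  have : Primrec₂ fun (_ : ℕ) (l : List Str) => l.map (List.cons false) ++ l.map (List.cons true) :=
    (Primrec.list_append.comp ((hc false).comp Primrec.snd) ((hc true).comp Primrec.snd)).to₂
  refine (Primrec.nat_rec₁ [[]] this).of_eq fun n => ?_
  induction n with
  | zero => rfl
  | succ n ih => simp only [strs, ← ih]

theorem _root_.Primrec.list_count_true : Primrec fun l : List Bool => l.count true := by
  have hp : PrimrecPred fun b : Bool => b = true := Primrec.eq.comp Primrec.id (Primrec.const true)
  refine (Primrec.list_length.comp (Primrec.listFilter hp)).of_eq fun l => ?_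
  rw [List.count_eq_length_filter]
  congr 2

section

variable {O : Set (ℕ →. ℕ)} {α : Type} [Primcodable α]

theorem _root_.Primrec.nat_pow' : Primrec₂ ((· ^ ·) : ℕ → ℕ → ℕ) :=
  Primrec₂.unpaired'.1 Nat.Primrec.pow

theorem _root_.ComputableIn.mul {f g : α → ℕ} (hf : ComputableIn O f) (hg : ComputableIn O g) :
    ComputableIn O fun a => f a * g a := ComputableIn₂.comp Primrec.nat_mul.computableIn₂ hf hg

theorem _root_.ComputableIn.add {f g : α → ℕ} (hf : ComputableIn O f) (hg : ComputableIn O g) :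
    ComputableIn O fun a => f a + g a := ComputableIn₂.comp Primrec.nat_add.computableIn₂ hf hg

theorem _root_.ComputableIn.two_pow {f : α → ℕ} (hf : ComputableIn O f) :
    ComputableIn O fun a => 2 ^ f a :=
  ComputableIn₂.comp Primrec.nat_pow'.computableIn₂ (.const 2) hf

theorem _root_.ComputableIn.decide_le {f g : α → ℕ} (hf : ComputableIn O f)
    (hg : ComputableIn O g) : ComputableIn O fun a => decide (f a ≤ g a) :=
  ComputableIn₂.comp (f := fun m n : ℕ => decide (m ≤ n)) Primrec.nat_le.decide.computableIn₂ hf hg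

theorem _root_.ComputableIn.and {f g : α → Bool} (hf : ComputableIn O f)
    (hg : ComputableIn O g) : ComputableIn O fun a => f a && g a :=
  ComputableIn₂.comp Primrec.and.computableIn₂ hf hg

theorem _root_.ComputableIn.or {f g : α → Bool} (hf : ComputableIn O f)
    (hg : ComputableIn O g) : ComputableIn O fun a => f a || g a :=
  ComputableIn₂.comp Primrec.or.computableIn₂ hf hg

theorem _root_.ComputableIn.not {f : α → Bool} (hf : ComputableIn O f) :
    ComputableIn O fun a => !f a :=
  ComputableIn.comp Primrec.not.computableIn hf

theorem _root_.ComputableIn₂.cnt [Inhabited α] {C : α → Str → Bool} (hC : ComputableIn₂ O C) :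
    ComputableIn₂ O fun a m => cnt (C a) m := by
  have hq : Primrec fun p : α × ℕ => (strs p.2).map fun σ => (p.1, σ) :=
    Primrec.list_map (primrec_strs.comp Primrec.snd)
      ((Primrec.fst.comp Primrec.fst).pair Primrec.snd).to₂
  have := ComputableIn.of_queries hC hq (h := fun _ l => l.count true)
    (Primrec.list_count_true.comp Primrec.snd).to₂
  refine this.of_eq fun p => ?_
  simp only [Randomness.cnt, List.map_map]
  rfl

theorem _root_.Primrec.list_all_id : Primrec fun l : List Bool => l.all id := by
  have : PrimrecPred fun l : List Bool => ∀ a ∈ l, a = true :=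
    PrimrecPred.forall_mem_list (Primrec.eq.comp Primrec.id (Primrec.const true))
  refine this.decide.of_eq fun l => ?_
  rw [Bool.eq_iff_iff]
  simp

end

theorem inv_two_pow_mul_le_iff {m n a : ℕ} :
    (2⁻¹ : ℝ≥0∞) ^ m * a ≤ 2⁻¹ ^ n ↔ a * 2 ^ n ≤ 2 ^ m := by
  have h2 : ∀ k : ℕ, (2 : ℝ≥0∞) ^ k ≠ 0 := fun k => by positivity
  have h2' : ∀ k : ℕ, (2 : ℝ≥0∞) ^ k ≠ ⊤ := fun k => by finiteness
  rw [← ENNReal.inv_pow, ← ENNReal.inv_pow, ENNReal.le_inv_iff_mul_le, mul_assoc, mul_comm,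
    ← div_eq_mul_inv, ENNReal.div_le_iff (h2 m) (h2' m), one_mul]
  exact_mod_cast Iff.rfl

/-! ### Martin-Löf random sequences and effectively closed sets -/

/-- Martin-Löf random sequences are in all c.e. open sets of full measure. -/
theorem mem_hull_of_lebesgue_eq_one {Z : Cantor} (hZ : Z ∈ MLR ∅) {c : Str → Bool}
    (hc : ComputableIn ∅ c) (hup : Upward c) (h1 : lebesgue (hull c) = 1) : Z ∈ hull c := by
  by_contra hZc
  let c' : Str → Bool := fun τ => !c τ
  have hcompl : ∀ m, lebesgue {X | c' (prefixOf X m) = true} =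
      1 - lebesgue {X | c (prefixOf X m) = true} := by
    intro m
    rw [← prob_compl_eq_one_sub (measurableSet_prefixOf c m)]
    congr 1
    ext X
    simp [c']
  have htend : Tendsto (fun m => lebesgue {X | c' (prefixOf X m) = true}) atTop (𝓝 0) := by
    simp only [hcompl]
    have := ENNReal.Tendsto.sub (tendsto_const_nhds (x := (1 : ℝ≥0∞)))
      (tendsto_lebesgue_hull hup) (Or.inl ENNReal.one_ne_top)
    rwa [h1, tsub_self] at this
  have hex : ∀ n, ∃ m, cnt c' m * 2 ^ n ≤ 2 ^ m := by
    intro n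
    have hpos : (0 : ℝ≥0∞) < 2⁻¹ ^ n := ENNReal.pow_pos (by simp) n
    obtain ⟨m, hm⟩ := (htend.eventually (gt_mem_nhds hpos)).exists
    rw [lebesgue_prefixOf] at hm
    exact ⟨m, inv_two_pow_mul_le_iff.1 hm.le⟩
  -- The clopen approximations to the complement of `hull c` decrease to a null set. All
  -- approximations of measure at most `2⁻¹ ^ n` are put into component `n`; they lie in the first
  -- of them, which bounds the measure.
  let 𝒰 : ℕ → Set Cantor := fun n =>
    {X | ∃ m, c' (prefixOf X m) = true ∧ cnt c' m * 2 ^ n ≤ 2 ^ m}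
  refine hZ 𝒰 ⟨?_, ?_, ?_⟩ (Set.mem_iInter.2 fun n => ?_)
  · have hc' : ComputableIn ∅ c' := hc.not
    have hcnt : ComputableIn ∅ fun m => cnt c' m :=
      ComputableIn₂.comp (f := fun (_ : ℕ) m => cnt c' m)
        (ComputableIn₂.cnt (C := fun (_ : ℕ) => c') (hc'.comp .snd)) .id .id
    have hlen : ComputableIn ∅ fun q : (ℕ × Str) × ℕ => q.1.2.length :=
      (Primrec.list_length.comp (Primrec.snd.comp Primrec.fst)).computableIn
    refine uniformlyCEOpen_of_rel (R := fun q => c' q.1.2 &&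
      decide (cnt c' q.1.2.length * 2 ^ q.1.1 ≤ 2 ^ q.1.2.length)) ?_ ?_
    · exact (hc'.comp (Primrec.snd.comp Primrec.fst).computableIn).and
        (((hcnt.comp hlen).mul (ComputableIn.two_pow
          (Primrec.fst.comp Primrec.fst).computableIn)).decide_le hlen.two_pow)
    · intro n X
      simp [𝒰]
  · refine antitone_nat_of_succ_le fun n X => ?_
    rintro ⟨m, hm, h⟩
    refine ⟨m, hm, le_trans ?_ h⟩
    gcongr <;> omega
  · intro n
    classical
    refine le_trans (measure_mono (t := {X | c' (prefixOf X (Nat.find (hex n))) = true}) ?_) ?_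
    · rintro X ⟨m, hm, h⟩
      by_contra hX
      have hle : Nat.find (hex n) ≤ m := Nat.find_min' _ h
      have : c (prefixOf X m) = true := mem_prefixOf_mono hup hle (by simpa [c'] using hX)
      simp [c', this] at hm
    · rw [lebesgue_prefixOf]
      exact inv_two_pow_mul_le_iff.2 (Nat.find_spec (hex n))
  · obtain ⟨m, hm⟩ := hex n
    refine ⟨m, ?_, hm⟩
    have : c (prefixOf Z m) ≠ true := fun h => hZc ⟨m, h⟩
    simpa [c'] using this

theorem lebesgue_shift_preimage (k : ℕ) {S : Set Cantor} (hS : MeasurableSet S) :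
    lebesgue (shift k ⁻¹' S) = lebesgue S := by
  induction k generalizing S with
  | zero => rfl
  | succ k ih =>
    have h : shift (k + 1) ⁻¹' S = shift 1 ⁻¹' (shift k ⁻¹' S) := by
      ext X
      simp [shift_shift]
    have h1 : ∀ (T : Set Cantor) b, cons b ⁻¹' (shift 1 ⁻¹' T) = T := fun _ _ => rfl
    have hk : MeasurableSet (shift k ⁻¹' S) := (continuous_shift k).measurable hS
    rw [h, lebesgue_eq_cons ((continuous_shift 1).measurable hk), h1, h1, ih hS, ← two_mul,
      ← mul_assoc, ENNReal.inv_mul_cancel (by simp) (by simp), one_mul]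

theorem prefixOf_add (X : Cantor) (k m : ℕ) :
    prefixOf X (k + m) = prefixOf X k ++ prefixOf (shift k X) m := by
  conv_lhs => rw [← app_prefixOf_shift k X]
  have := prefixOf_app (prefixOf X k) (shift k X) m
  rwa [length_prefixOf] at this

/-- The preimage of `hull c` under a shift is again a c.e. open set of full measure. -/
theorem shift_mem_hull_of_lebesgue_eq_one {Z : Cantor} (hZ : Z ∈ MLR ∅) {c : Str → Bool}
    (hc : ComputableIn ∅ c) (hup : Upward c) (h1 : lebesgue (hull c) = 1) (k : ℕ) :
    shift k Z ∈ hull c := by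
  have hdrop : hull (fun τ => c (τ.drop k)) = shift k ⁻¹' hull c := by
    ext X
    constructor
    · rintro ⟨m, hm⟩
      refine ⟨m - k, hup _ _ ?_ hm⟩
      rcases le_total k m with h | h
      · obtain ⟨j, rfl⟩ := Nat.exists_eq_add_of_le h
        rw [prefixOf_add, List.drop_left' (by simp), Nat.add_sub_cancel_left]
      · rw [List.drop_eq_nil_of_le (by simpa using h)]
        exact List.nil_prefix
    · rintro ⟨m, hm⟩
      refine ⟨k + m, ?_⟩
      change c ((prefixOf X (k + m)).drop k) = true
      rwa [prefixOf_add, List.drop_left' (by simp)]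
  have := mem_hull_of_lebesgue_eq_one hZ (c := fun τ => c (τ.drop k))
    (hc.comp (Primrec.list_drop.comp (Primrec.const k) Primrec.id).computableIn)
    (fun σ τ h => hup _ _ (h.drop k))
    (by rw [hdrop, lebesgue_shift_preimage k (measurableSet_hull c), h1])
  rwa [hdrop] at this

/-- The set of sequences that begin with a concatenation of `j` strings from `W`. -/
def concat (W : Set Str) : ℕ → Set Cantor
  | 0 => Set.univ
  | j + 1 => ⋃ w ∈ W, glue w (concat W j)

theorem measurableSet_concat (W : Set Str) (j : ℕ) : MeasurableSet (concat W j) := by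
  induction j with
  | zero => exact .univ
  | succ j ih => exact .biUnion (Set.to_countable _) fun w _ => measurableSet_glue w ih

theorem antitone_concat (W : Set Str) : Antitone (concat W) := by
  refine antitone_nat_of_succ_le fun j => ?_
  induction j with
  | zero => exact Set.subset_univ _
  | succ j ih => exact Set.biUnion_mono subset_rfl fun w _ X hX => ⟨hX.1, ih hX.2⟩

theorem lebesgue_openGen {W : Set Str} (hW : PrefixFree W) :
    lebesgue (openGen W) = ∑' w : W, 2⁻¹ ^ (w : Str).length := by
  rw [openGen, measure_biUnion (Set.to_countable _)]
  · simp only [lebesgue_cyl]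
  · intro σ hσ τ hτ hne
    refine Set.disjoint_left.2 fun X (h1 : _ = _) (h2 : _ = _) => hne ?_
    rcases le_total σ.length τ.length with h | h
    · exact hW σ hσ τ hτ (by have := prefixOf_prefix X h; rwa [h1, h2] at this)
    · exact (hW τ hτ σ hσ (by have := prefixOf_prefix X h; rwa [h1, h2] at this)).symm
  · intro w _
    exact (isClopen_prefixOf {w} w.length).isOpen.measurableSet

/-- After a string from `W` the rest of the sequence is independent of it, so each further block
costs a factor of at most the measure of `openGen W`. -/
theorem lebesgue_concat_le {W : Set Str} (hW : PrefixFree W) (j : ℕ) :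
    lebesgue (concat W j) ≤ lebesgue (openGen W) ^ j := by
  induction j with
  | zero => simp [concat]
  | succ j ih =>
    calc lebesgue (concat W (j + 1)) ≤ ∑' w : W, lebesgue (glue w (concat W j)) :=
          measure_biUnion_le _ (Set.to_countable _) _
      _ = lebesgue (openGen W) * lebesgue (concat W j) := by
          simp only [lebesgue_glue _ (measurableSet_concat W j)]
          rw [ENNReal.tsum_mul_right, lebesgue_openGen hW]
      _ ≤ _ := by rw [pow_succ']; gcongr

theorem mem_concat_iff {W : Set Str} {j : ℕ} {X : Cantor} : X ∈ concat W j ↔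
    ∃ m, ∃ l : List Str, l.length = j ∧ l.flatten = prefixOf X m ∧ ∀ w ∈ l, w ∈ W := by
  induction j generalizing X with
  | zero => exact ⟨fun _ => ⟨0, [], by simp⟩, fun _ => trivial⟩
  | succ j ih =>
    simp only [concat, Set.mem_iUnion, exists_prop, glue, Set.mem_ofPred_eq, ih]
    constructor
    · rintro ⟨w, hw, hX, m, l, hl, hlX, hlW⟩
      refine ⟨w.length + m, w :: l, by simp [hl], ?_, by simpa using ⟨hw, hlW⟩⟩
      rw [prefixOf_add, hX, List.flatten_cons, hlX]
    · rintro ⟨m, _ | ⟨w, l⟩, hl, hlX, hlW⟩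
      · simp at hl
      · have hm : m = w.length + l.flatten.length := by
          have := congrArg List.length hlX
          simp only [List.flatten_cons, List.length_append, length_prefixOf] at this
          exact this.symm
        rw [hm, prefixOf_add, List.flatten_cons] at hlX
        have h := List.append_inj hlX (by simp)
        exact ⟨w, hlW w (by simp), h.1.symm, _, l, by simpa using hl, h.2,
          fun v hv => hlW v (by simp [hv])⟩

/-- Deleting a prefix in `W` leaves another tail of `X`, to which the hypothesis applies again. -/
theorem mem_concat_of_forall_shift {W : Set Str} {X : Cantor}
    (h : ∀ k, shift k X ∈ openGen W) (j : ℕ) : X ∈ concat W j := by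
  induction j generalizing X with
  | zero => trivial
  | succ j ih =>
    obtain ⟨m, hm⟩ := mem_openGen.1 (h 0)
    refine Set.mem_biUnion hm ⟨by simp; rfl, ih fun k => ?_⟩
    rw [shift_shift]
    exact h _

/-- Kučera's theorem: a Martin-Löf random sequence has a tail outside any given c.e. open set of
measure less than one. -/
theorem exists_shift_notMem_hull {Z : Cantor} (hZ : Z ∈ MLR ∅) {c : Str → Bool}
    (hc : ComputableIn ∅ c) (hup : Upward c) (h1 : lebesgue (hull c) < 1) :
    ∃ k, shift k Z ∉ hull c := by
  by_contra! hall
  have hdec : IsDecFamily ∅ fun _ => c := ⟨hc.comp .snd, fun _ => hup⟩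
  set W : Set Str := {τ | minimal c τ = true}
  have hW : PrefixFree W := prefixFree_minimal hup
  -- Blocks of `N` strings shrink the measure by at least a factor of two, so the sets `concat W (N
  -- * n)` form a Martin-Löf test. If all tails of `Z` were in `hull c`, then `Z` would fail it.
  obtain ⟨N, hN⟩ : ∃ N, lebesgue (hull c) ^ N < 2⁻¹ :=
    ((ENNReal.tendsto_pow_atTop_nhds_zero_of_lt_one h1).eventually
      (gt_mem_nhds (by simp : (0 : ℝ≥0∞) < 2⁻¹))).exists
  refine hZ (fun n => concat W (N * n)) ⟨?_, ?_, ?_⟩ (Set.mem_iInter.2 fun n =>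
    mem_concat_of_forall_shift (fun k => openGen_minimal ▸ hall k) _)
  -- The witness `b` codes a list of strings. A number that codes none is read as `[]`, which is
  -- harmless, as the decoded list itself is checked.
  · let D : ℕ → List Str := fun b => (Encodable.decode (α := List Str) b).getD []
    have hD : Primrec D := Primrec.option_getD.comp Primrec.decode (Primrec.const [])
    have hmin : ComputableIn ∅ (minimal c) :=
      hdec.computableIn_minimal.comp ((Primrec.const 0).pair Primrec.id).computableIn
    refine uniformlyCEOpen_of_rel (R := fun q => (decide ((D q.2).length = N * q.1.1) &&
      decide ((D q.2).flatten = q.1.2)) && ((D q.2).map (minimal c)).all id) ?_ ?_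
    · have hDq : Primrec fun q : (ℕ × Str) × ℕ => D q.2 := hD.comp Primrec.snd
      refine ComputableIn.and (Primrec.computableIn ?_) ?_
      · exact Primrec.and.comp (Primrec.eq.decide.comp (Primrec.list_length.comp hDq)
          (Primrec.nat_mul.comp (Primrec.const N) (Primrec.fst.comp Primrec.fst)))
          (Primrec.eq.decide.comp (Primrec.list_flatten.comp hDq) (Primrec.snd.comp Primrec.fst))
      · exact ComputableIn.of_queries hmin hDq (h := fun _ l => l.all id)
          (Primrec.list_all_id.comp Primrec.snd).to₂
    · intro n X
      rw [mem_concat_iff]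
      refine exists_congr fun m => ⟨fun ⟨l, h1, h2, h3⟩ => ⟨Encodable.encode l, ?_⟩,
        fun ⟨b, h⟩ => ⟨D b, ?_⟩⟩
      · have : D (Encodable.encode l) = l := by simp [D]
        simp only [this, h1, h2]
        simpa [W] using h3
      · simpa [W, and_assoc] using h
  · exact (antitone_concat W).comp_monotone fun a b h => Nat.mul_le_mul_left N h
  · intro n
    refine (lebesgue_concat_le hW _).trans ?_
    rw [openGen_minimal, pow_mul]
    gcongr

theorem exists_prefixOf_subset {G : Set Cantor} (hG : IsOpen G) {Y : Cantor} (hY : Y ∈ G) :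
    ∃ l, ∀ X, prefixOf X l = prefixOf Y l → X ∈ G := by
  obtain ⟨I, u, hu, hsub⟩ := isOpen_pi_iff.1 hG Y hY
  obtain ⟨l, hl⟩ := I.exists_nat_subset_range
  refine ⟨l, fun X hX => hsub fun i hi => ?_⟩
  have : X i = Y i := by
    have hil : i < l := Finset.mem_range.1 (hl hi)
    have := congrArg (fun τ : Str => τ[i]?) hX
    simpa [prefixOf, hil] using this
  exact this ▸ (hu i hi).2

/-! ### Forcing with effectively closed sets of positive measure -/

/-- The complement of `hull c` is an effectively closed set of positive measure that contains only
sequences `X` with `X 0 = true`. -/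
structure IsCondition (c : Str → Bool) : Prop where
  computable : ComputableIn ∅ c
  upward : Upward c
  lebesgue_lt : lebesgue (hull c) < 1
  zero : ∀ X : Cantor, X 0 = false → X ∈ hull c

theorem hull_or (c d : Str → Bool) : hull (fun τ => c τ || d τ) = hull c ∪ hull d := by
  ext X
  simp [hull, exists_or]

theorem Upward.or {c d : Str → Bool} (hc : Upward c) (hd : Upward d) :
    Upward fun τ => c τ || d τ := by
  intro σ τ h
  simp only [Bool.or_eq_true]
  exact Or.imp (hc σ τ h) (hd σ τ h)

theorem isCondition_head : IsCondition fun τ => decide (τ.head? = some false) := by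
  have hmem : ∀ X : Cantor, X 0 = false ↔ X ∈ hull fun τ => decide (τ.head? = some false) := by
    intro X
    refine ⟨fun h => ⟨1, by simp [prefixOf, h]⟩, ?_⟩
    rintro ⟨_ | m, hm⟩
    · simp at hm
    · rw [← cons_shift_one X, prefixOf_cons] at hm
      simpa using hm
  refine ⟨(Primrec.eq.decide.comp Primrec.list_head? (Primrec.const _)).computableIn, ?_, ?_,
    fun X => (hmem X).1⟩
  · rintro σ τ ⟨r, rfl⟩ h
    rcases σ with _ | ⟨b, σ⟩ <;> simp_all
  · have : hull (fun τ => decide (τ.head? = some false)) = cyl [false] := by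
      ext X
      rw [← hmem]
      simp [cyl, prefixOf]
    rw [this, lebesgue_cyl]
    simp

/-- Some component of the test has measure below `1 - lebesgue (hull c)`, and removing it leaves
positive measure. -/
theorem IsCondition.exists_avoid {c : Str → Bool} (hc : IsCondition c) {𝒰 : ℕ → Set Cantor}
    (h𝒰 : IsGenMLTest ∅ 𝒰) : ∃ d, IsCondition d ∧ hull c ⊆ hull d ∧ ∃ m, 𝒰 m ⊆ hull d := by
  obtain ⟨C, hC, hCU⟩ := h𝒰.1.exists_isDecFamily totalOracles_empty
  obtain ⟨m, hm⟩ := (h𝒰.2.eventually (gt_mem_nhds (tsub_pos_of_lt hc.lebesgue_lt))).exists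
  have hu := hull_or c (C m)
  refine ⟨fun τ => c τ || C m τ, ⟨hc.computable.or (ComputableIn₂.comp hC.computable
    (.const m) .id), hc.upward.or (hC.upward m), ?_, fun X hX => hu ▸ Or.inl (hc.zero X hX)⟩,
    hu ▸ Set.subset_union_left, m, ?_⟩
  · rw [hu]
    refine (measure_union_le _ _).trans_lt ?_
    rw [← hCU, add_comm]
    exact lt_tsub_iff_right.1 hm
  · rw [hu, hCU]
    exact Set.subset_union_right

/-- By Kučera's theorem a tail of `Z` lies in the closed set, so it begins with `true` and lies in
`G`. The closed set is then restricted to a cylinder around this tail that is contained in `G`. -/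
theorem IsCondition.exists_enter {c : Str → Bool} (hc : IsCondition c) {Z : Cantor}
    (hZ : Z ∈ MLR ∅) {G : Set Cantor} (hG : IsOpen G)
    (hZG : ∀ k, shift k Z 0 = true → shift k Z ∈ G) :
    ∃ d, IsCondition d ∧ hull c ⊆ hull d ∧ (hull d)ᶜ ⊆ G := by
  obtain ⟨k, hk⟩ := exists_shift_notMem_hull hZ hc.computable hc.upward hc.lebesgue_lt
  set Y := shift k Z
  have hY0 : Y 0 = true := by
    by_contra h
    exact hk (hc.zero Y (by simpa using h))
  obtain ⟨l, hl⟩ := exists_prefixOf_subset hG (hZG k hY0)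
  -- `hull d` is the complement of the cylinder of `prefixOf Y l`.
  let d : Str → Bool := fun τ => decide (l ≤ τ.length) && !decide (τ.take l = prefixOf Y l)
  have hd : ∀ X, X ∈ hull d ↔ prefixOf X l ≠ prefixOf Y l := by
    intro X
    simp only [hull, d, Set.mem_ofPred_eq, length_prefixOf, Bool.and_eq_true, decide_eq_true_eq,
      Bool.not_eq_true', decide_eq_false_iff_not]
    refine ⟨fun ⟨m, h1, h2⟩ => take_prefixOf X h1 ▸ h2, fun h => ⟨l, le_rfl, ?_⟩⟩
    rwa [take_prefixOf X le_rfl]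
  have hdup : Upward d := by
    rintro σ τ ⟨r, rfl⟩
    simp only [d, Bool.and_eq_true, decide_eq_true_eq, Bool.not_eq_true',
      decide_eq_false_iff_not, List.length_append]
    rintro ⟨h1, h2⟩
    refine ⟨by omega, ?_⟩
    rwa [List.take_append_of_le_length h1]
  have hdc : ComputableIn ∅ d :=
    ((ComputableIn.const l).decide_le Primrec.list_length.computableIn).and
      (ComputableIn.not (Primrec.eq.decide.comp (Primrec.list_take.comp (Primrec.const l)
        Primrec.id) (Primrec.const (prefixOf Y l))).computableIn)
  have hu := hull_or c d
  refine ⟨fun τ => c τ || d τ, ⟨hc.computable.or hdc, hc.upward.or hdup, ?_,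
    fun X hX => hu ▸ Or.inl (hc.zero X hX)⟩, hu ▸ Set.subset_union_left, ?_⟩
  -- If the restricted closed set were null, the tail `Y` of a Martin-Löf random sequence could not
  -- belong to it.
  · refine lt_of_le_of_ne prob_le_one fun h1 => ?_
    have := shift_mem_hull_of_lebesgue_eq_one hZ (hc.computable.or hdc) (hc.upward.or hdup) h1 k
    rw [hu] at this
    rcases this with h | h
    · exact hk h
    · exact (hd Y).1 h rfl
  · intro X hX
    rw [hu] at hX
    refine hl X ?_
    by_contra h
    exact hX (Or.inr ((hd X).2 h))

/-- If `Z` is Martin-Löf random, then any countably many open sets that contain all tails of `Z`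
that begin with `true` have a weakly 2-random sequence in common. -/
theorem exists_mem_W2R {Z : Cantor} (hZ : Z ∈ MLR ∅) {G : ℕ → Set Cantor}
    (hG : ∀ n, IsOpen (G n)) (hZG : ∀ n k, shift k Z 0 = true → shift k Z ∈ G n) :
    ∃ Y ∈ W2R ∅, Y 0 = true ∧ ∀ n, Y ∈ G n := by
  obtain ⟨f, hf⟩ := Set.countable_iff_exists_subset_range.1 countable_uniformlyCEOpen_empty
  have step : ∀ (n : ℕ) (c : {c // IsCondition c}), ∃ d : {c // IsCondition c},
      hull c.1 ⊆ hull d.1 ∧ (hull d.1)ᶜ ⊆ G n ∧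
        (IsGenMLTest ∅ (f n) → ∃ m, f n m ⊆ hull d.1) := by
    rintro n ⟨c, hc⟩
    obtain ⟨d, hd, hcd, hdf⟩ : ∃ d, IsCondition d ∧ hull c ⊆ hull d ∧
        (IsGenMLTest ∅ (f n) → ∃ m, f n m ⊆ hull d) := by
      by_cases h : IsGenMLTest ∅ (f n)
      · obtain ⟨d, h1, h2, h3⟩ := hc.exists_avoid h
        exact ⟨d, h1, h2, fun _ => h3⟩
      · exact ⟨c, hc, subset_rfl, fun h' => absurd h' h⟩
    obtain ⟨e, he, hde, heG⟩ := hd.exists_enter hZ (hG n) (hZG n)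
    exact ⟨⟨e, he⟩, hcd.trans hde, heG, fun h => (hdf h).imp fun m hm => hm.trans hde⟩
  choose next h1 h2 h3 using step
  let c : ℕ → {c // IsCondition c} := fun n => Nat.rec ⟨_, isCondition_head⟩ next n
  -- The conditions form a decreasing sequence of nonempty compact sets, and any common point is as
  -- required.
  have hne : (⋂ n, (hull (c n).1)ᶜ).Nonempty := by
    refine IsCompact.nonempty_iInter_of_sequence_nonempty_isCompact_isClosed _
      (fun n => Set.compl_subset_compl.2 (h1 n (c n))) (fun n => ?_) ?_ fun n => ?_
    · rw [Set.nonempty_compl]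
      intro h
      have := (c n).2.lebesgue_lt
      simp [h] at this
    · exact (isOpen_hull _).isClosed_compl.isCompact
    · exact (isOpen_hull _).isClosed_compl
  obtain ⟨Y, hY⟩ := hne
  have hYn : ∀ n, Y ∉ hull (c n).1 := fun n => Set.mem_iInter.1 hY n
  refine ⟨Y, fun 𝒰 h𝒰 hmem => ?_, ?_, fun n => h2 n (c n) (hYn (n + 1))⟩
  · obtain ⟨n, rfl⟩ := hf h𝒰.1
    obtain ⟨m, hm⟩ := h3 n (c n) h𝒰
    exact hYn (n + 1) (hm (Set.mem_iInter.1 hmem m))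
  · by_contra h
    exact hYn 0 ((c 0).2.zero Y (by simpa using h))

/-! ### Reduction to open sets that contain the tails of `Z` -/

theorem MLR_antitone {O O' : Set (ℕ →. ℕ)} (h : O ⊆ O') : MLR O' ⊆ MLR O := by
  rintro X hX 𝒰 ⟨⟨W, hW, hpf, hU⟩, h2⟩
  exact hX 𝒰 ⟨⟨W, RecursiveIn.mono h hW, hpf, hU⟩, h2⟩

theorem W2R_subset_MLR (O : Set (ℕ →. ℕ)) : W2R O ⊆ MLR O := by
  rintro X hX 𝒰 ⟨h1, -, h3⟩
  refine hX 𝒰 ⟨h1, tendsto_of_tendsto_of_tendsto_of_le_of_le tendsto_const_nhds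
    (ENNReal.tendsto_pow_atTop_nhds_zero_of_lt_one (by simp : (2⁻¹ : ℝ≥0∞) < 1))
    (fun _ => zero_le) h3⟩

/-- If every Martin-Löf random `Z` outside `S` has open sets as in `exists_mem_W2R` whose
intersection is disjoint from `S`, then `S` contains all Martin-Löf random sequences as soon as it
contains all weakly 2-random ones. -/
theorem MLR_subset_of_W2R_subset {S : Set Cantor} (hS : W2R ∅ ⊆ S)
    (h : ∀ Z, Z ∉ S → ∃ G : ℕ → Set Cantor, (∀ n, IsOpen (G n)) ∧
      (∀ n k, shift k Z 0 = true → shift k Z ∈ G n) ∧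
      ∀ Y, Y 0 = true → (∀ n, Y ∈ G n) → Y ∉ S) : MLR ∅ ⊆ S := by
  intro Z hZ
  by_contra hZS
  obtain ⟨G, h1, h2, h3⟩ := h Z hZS
  obtain ⟨Y, hY, hY0, hYG⟩ := exists_mem_W2R hZ h1 h2
  exact h3 Y hY0 hYG (hS hY)

/-! ### Spread tests and the Martin-Löf case -/

/-- An enumeration of all strings, with repetitions. -/
def str (e : ℕ) : Str := ((Encodable.decode e).getD []).take e

/-- The truncation in `str` loses nothing, since a list is no longer than its code. It is there to
force `length_str_le`, which bounds the dilation by `str e` by `2 ^ e`. -/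
theorem str_encode (ρ : Str) : str (Encodable.encode ρ) = ρ := by
  simp [str, Encodable.length_le_encode]

theorem primrec_str : Primrec str := Primrec.list_take.comp Primrec.id
  (Primrec.option_getD.comp Primrec.decode (Primrec.const []))

theorem length_str_le (e : ℕ) : (str e).length ≤ e := by
  simp [str]

section

variable {O : Set (ℕ →. ℕ)}

/-- The sequences `X` such that `ρ X` is, for some string `ρ`, in a component of the test `𝒰` the
index of which depends on `n` and `ρ`. -/
def spread (𝒰 : ℕ → Set Cantor) (n : ℕ) : Set Cantor :=
  ⋃ e, app (str e) ⁻¹' 𝒰 (n + 2 * e + 1)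

theorem app_mem_hull {c : Str → Bool} (hc : Upward c) {ρ : Str} {X : Cantor} :
    app ρ X ∈ hull c ↔ ∃ m, c (ρ ++ prefixOf X m) = true := by
  constructor
  · rintro ⟨m, hm⟩
    refine ⟨m, ?_⟩
    rw [← prefixOf_app]
    exact mem_prefixOf_mono hc (by omega) hm
  · rintro ⟨m, hm⟩
    exact ⟨ρ.length + m, by rwa [prefixOf_app]⟩

theorem isOpen_spread {𝒰 : ℕ → Set Cantor} (h : ∀ n, IsOpen (𝒰 n)) (n : ℕ) :
    IsOpen (spread 𝒰 n) :=
  isOpen_iUnion fun e => (h _).preimage (continuous_app (str e))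

theorem antitone_spread {𝒰 : ℕ → Set Cantor} (h : Antitone 𝒰) : Antitone (spread 𝒰) :=
  fun a b hab => Set.iUnion_mono fun e => Set.preimage_mono (h (by omega))

theorem shift_mem_spread {𝒰 : ℕ → Set Cantor} {Z : Cantor} (hZ : Z ∈ ⋂ n, 𝒰 n) (n k : ℕ) :
    shift k Z ∈ spread 𝒰 n := by
  refine Set.mem_iUnion.2 ⟨Encodable.encode (prefixOf Z k), ?_⟩
  rw [str_encode, Set.mem_preimage, app_prefixOf_shift]
  exact Set.mem_iInter.1 hZ _

theorem lebesgue_app_str_le {S : Set Cantor} (hS : MeasurableSet S) (e : ℕ) :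
    lebesgue (app (str e) ⁻¹' S) ≤ 2 ^ e * lebesgue S :=
  (lebesgue_app_preimage_le _ hS).trans (by
    gcongr
    · norm_num
    · exact length_str_le e)

theorem two_pow_mul_inv_two_pow (e k : ℕ) : (2 : ℝ≥0∞) ^ e * 2⁻¹ ^ (k + e) = 2⁻¹ ^ k := by
  rw [pow_add, mul_left_comm, ← mul_pow, ENNReal.mul_inv_cancel (by simp) (by simp), one_pow,
    mul_one]

theorem tsum_inv_two_pow (k : ℕ) : ∑' e : ℕ, (2⁻¹ : ℝ≥0∞) ^ (k + 1 + e) = 2⁻¹ ^ k := by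
  simp only [pow_add _ (k + 1)]
  rw [ENNReal.tsum_mul_left, ENNReal.tsum_geometric, ENNReal.one_sub_inv_two, inv_inv, pow_succ,
    mul_assoc, ENNReal.inv_mul_cancel (by simp) (by simp), mul_one]

/-- In the index `n + 2 * e + 1`, one `e` absorbs the dilation by `str e`, the other makes the sum
over `e` converge, and the 1 brings this sum to `2⁻¹ ^ n`. -/
theorem lebesgue_app_test_le {𝒰 : ℕ → Set Cantor} (hm : ∀ n, MeasurableSet (𝒰 n))
    (h : ∀ n, lebesgue (𝒰 n) ≤ (2⁻¹ : ℝ≥0∞) ^ n) (n e : ℕ) :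
    lebesgue (app (str e) ⁻¹' 𝒰 (n + 2 * e + 1)) ≤ 2⁻¹ ^ (n + 1 + e) :=
  calc _ ≤ 2 ^ e * lebesgue (𝒰 (n + 2 * e + 1)) := lebesgue_app_str_le (hm _) e
    _ ≤ 2 ^ e * 2⁻¹ ^ ((n + 1 + e) + e) := by
        gcongr
        exact (h _).trans (le_of_eq (by congr 1; omega))
    _ = _ := two_pow_mul_inv_two_pow _ _

theorem lebesgue_spread_le {𝒰 : ℕ → Set Cantor} (hm : ∀ n, MeasurableSet (𝒰 n))
    (h : ∀ n, lebesgue (𝒰 n) ≤ (2⁻¹ : ℝ≥0∞) ^ n) (n : ℕ) :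
    lebesgue (spread 𝒰 n) ≤ 2⁻¹ ^ n :=
  calc _ ≤ ∑' e, lebesgue (app (str e) ⁻¹' 𝒰 (n + 2 * e + 1)) := measure_iUnion_le _
    _ ≤ ∑' e : ℕ, 2⁻¹ ^ (n + 1 + e) := ENNReal.tsum_le_tsum fun e => lebesgue_app_test_le hm h n e
    _ = _ := tsum_inv_two_pow n

theorem mem_spread_hull {C : ℕ → Str → Bool} (hC : ∀ n, Upward (C n)) {n : ℕ} {X : Cantor} :
    X ∈ spread (fun n => hull (C n)) n ↔
      ∃ m e, C (n + 2 * e + 1) (str e ++ prefixOf X m) = true := by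
  simp only [spread, Set.mem_iUnion, Set.mem_preimage, app_mem_hull (hC _)]
  exact exists_comm

theorem IsDecFamily.computable_spread {C : ℕ → Str → Bool} (hC : IsDecFamily O C) :
    ComputableIn O fun q : (ℕ × Str) × ℕ => C (q.1.1 + 2 * q.2 + 1) (str q.2 ++ q.1.2) := by
  refine ComputableIn₂.comp hC.computable (Primrec.computableIn ?_) (Primrec.computableIn ?_)
  · exact Primrec.succ.comp (Primrec.nat_add.comp (Primrec.fst.comp Primrec.fst)
      (Primrec.nat_double.comp Primrec.snd))
  · exact Primrec.list_append.comp (primrec_str.comp Primrec.snd) (Primrec.snd.comp Primrec.fst)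

theorem IsMLTest.spread (hO : TotalOracles O) {𝒰 : ℕ → Set Cantor} (h : IsMLTest O 𝒰) :
    IsMLTest O (spread 𝒰) ∧ ∀ n, IsOpen (Randomness.spread 𝒰 n) := by
  obtain ⟨h1, h2, h3⟩ := h
  obtain ⟨C, hC, hU⟩ := h1.exists_isDecFamily hO
  obtain rfl : 𝒰 = fun n => hull (C n) := funext hU
  refine ⟨⟨uniformlyCEOpen_of_rel hC.computable_spread fun n X => mem_spread_hull hC.upward,
    antitone_spread h2, lebesgue_spread_le (fun n => measurableSet_hull _) h3⟩,
    isOpen_spread fun n => isOpen_hull _⟩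

theorem MLR_subset_MLR_of_W2R_subset (hO : TotalOracles O) (h : W2R ∅ ⊆ MLR O) :
    MLR ∅ ⊆ MLR O := by
  refine MLR_subset_of_W2R_subset h fun Z hZ => ?_
  simp only [MLR, Set.mem_ofPred_eq, not_forall, not_not] at hZ
  obtain ⟨𝒰, h𝒰, hZ⟩ := hZ
  obtain ⟨h1, h2⟩ := h𝒰.spread hO
  exact ⟨spread 𝒰, h2, fun n k _ => shift_mem_spread hZ n k,
    fun Y _ hY hYR => hYR _ h1 (Set.mem_iInter.2 hY)⟩

end

/-! ### Initial intervals of Cantor space with prescribed measure -/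

section

variable {O : Set (ℕ →. ℕ)}

/-- The number with binary digits `τ`, most significant digit first. -/
def val (τ : Str) : ℕ := τ.foldl (fun v b => 2 * v + b.toNat) 0

theorem primrec_val : Primrec val := by
  refine Primrec.list_foldl (α := Str) (h := fun (_ : Str) (p : ℕ × Bool) => 2 * p.1 + p.2.toNat)
    Primrec.id (Primrec.const 0) ?_
  exact (Primrec.nat_add.comp (Primrec.nat_double.comp (Primrec.fst.comp Primrec.snd))
    ((Primrec.dom_bool Bool.toNat).comp (Primrec.snd.comp Primrec.snd))).to₂

theorem val_cons (b : Bool) (τ : Str) : val (b :: τ) = b.toNat * 2 ^ τ.length + val τ := by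
  have : ∀ (τ : Str) v, τ.foldl (fun v b => 2 * v + b.toNat) v = v * 2 ^ τ.length + val τ := by
    intro τ
    induction τ with
    | nil => simp [val]
    | cons b τ ih =>
      intro v
      simp only [val, List.foldl_cons, List.length_cons] at ih ⊢
      rw [ih (2 * v + b.toNat), ih (2 * 0 + b.toNat)]
      ring
  simp only [val, List.foldl_cons]
  rw [this τ]
  simp [val]

theorem val_concat (τ : Str) (b : Bool) : val (τ ++ [b]) = 2 * val τ + b.toNat := by
  simp [val]

theorem mem_strs {m : ℕ} {τ : Str} (h : τ ∈ strs m) : τ.length = m := by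
  induction m generalizing τ with
  | zero => simpa [strs] using h
  | succ m ih =>
    simp only [strs, List.mem_append, List.mem_map] at h
    rcases h with ⟨σ, hσ, rfl⟩ | ⟨σ, hσ, rfl⟩ <;> simp [ih hσ]

theorem map_val_strs (m : ℕ) : (strs m).map val = List.range (2 ^ m) := by
  induction m with
  | zero => rfl
  | succ m ih =>
    have h : ∀ b, (strs m).map (fun τ => val (b :: τ)) =
        (List.range (2 ^ m)).map fun k => b.toNat * 2 ^ m + k := by
      intro b
      rw [← ih, List.map_map]
      refine List.map_congr_left fun τ hτ => ?_
      simp [val_cons, mem_strs hτ]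
    have h0 := h false
    have h1 := h true
    simp only [strs, List.map_append, List.map_map, Function.comp_def, h0, h1]
    rw [pow_succ, mul_two, List.range_add]
    simp

/-- On strings of length `m`, `val` enumerates the numbers below `2 ^ m`, each once. -/
theorem cnt_val_lt (K m : ℕ) : cnt (fun τ => decide (val τ < K)) m = min K (2 ^ m) := by
  have h : (strs m).map (fun τ => decide (val τ < K)) =
      (List.range (2 ^ m)).map fun k => decide (k < K) := by
    rw [← map_val_strs, List.map_map]
    rfl
  rw [cnt, h]
  generalize 2 ^ m = N
  induction N with
  | zero => simp
  | succ N ih =>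
    rw [List.range_succ, List.map_append, List.count_append, ih]
    by_cases hN : N < K
    · simp [hN]; omega
    · simp [hN]; omega

/-- The sequences that are, as binary expansions, below `x`. -/
def below (x : ℝ) : Set Cantor :=
  {X | ∃ m, ((val (prefixOf X m) : ℝ) + 1) / 2 ^ m < x}

theorem below_mono {x y : ℝ} (h : x ≤ y) : below x ⊆ below y :=
  fun _ ⟨m, hm⟩ => ⟨m, hm.trans_le h⟩

theorem prefixOf_succ (X : Cantor) (m : ℕ) : prefixOf X (m + 1) = prefixOf X m ++ [X m] := by
  simp [prefixOf, List.range_succ]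

theorem val_prefixOf_antitone (X : Cantor) :
    Antitone fun m => ((val (prefixOf X m) : ℝ) + 1) / 2 ^ m := by
  refine antitone_nat_of_succ_le fun m => ?_
  rw [prefixOf_succ, val_concat, pow_succ', ← div_div]
  gcongr
  rw [div_le_iff₀ two_pos]
  cases X m <;> push_cast <;> simp <;> linarith

/-- The part of `below x` decided at length `m` consists of the strings with value less than `⌈x * 2
^ m⌉₊ - 1`. Its measure lies between `x - 1 / 2 ^ m` and `x`. -/
theorem lebesgue_below {x : ℝ} (h0 : 0 ≤ x) (h1 : x ≤ 1) :
    lebesgue (below x) = ENNReal.ofReal x := by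
  let S : ℕ → Set Cantor := fun m => {X | ((val (prefixOf X m) : ℝ) + 1) / 2 ^ m < x}
  have hS : below x = ⋃ m, S m := by ext; simp [below, S]
  have hmono : Monotone S := fun m n hmn X hX => (val_prefixOf_antitone X hmn).trans_lt hX
  have hlim : Tendsto (fun m => lebesgue (S m)) atTop (𝓝 (lebesgue (below x))) :=
    hS ▸ tendsto_measure_iUnion_atTop hmono
  refine tendsto_nhds_unique hlim ?_
  have hmeas : ∀ m, lebesgue (S m) =
      ENNReal.ofReal (((⌈x * 2 ^ m⌉₊ - 1 : ℕ) : ℝ) / 2 ^ m) := by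
    intro m
    have hset : S m = {X | (fun τ => decide (val τ < ⌈x * 2 ^ m⌉₊ - 1)) (prefixOf X m) = true} := by
      ext X
      simp only [S, Set.mem_ofPred_eq, decide_eq_true_eq]
      rw [div_lt_iff₀ (by positivity), Nat.lt_sub_iff_add_lt, Nat.lt_ceil]
      push_cast
      rfl
    have hle : ⌈x * 2 ^ m⌉₊ ≤ 2 ^ m := by
      rw [Nat.ceil_le]
      push_cast
      exact mul_le_of_le_one_left (by positivity) h1
    rw [hset, lebesgue_prefixOf fun τ => decide (val τ < ⌈x * 2 ^ m⌉₊ - 1), cnt_val_lt,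
      min_eq_left ((Nat.sub_le _ _).trans hle),
      ENNReal.ofReal_div_of_pos (by positivity), ENNReal.ofReal_natCast,
      ENNReal.ofReal_pow (by norm_num), ENNReal.ofReal_ofNat, div_eq_mul_inv, ENNReal.inv_pow,
      mul_comm]
  simp only [hmeas]
  refine (ENNReal.continuous_ofReal.tendsto x).comp ?_
  have hp : Tendsto (fun m : ℕ => x - 1 / 2 ^ m) atTop (𝓝 x) := by
    have : Tendsto (fun m : ℕ => (1 : ℝ) / 2 ^ m) atTop (𝓝 0) := by
      simpa using tendsto_pow_atTop_nhds_zero_of_lt_one (r := (2⁻¹ : ℝ)) (by norm_num) (by norm_num)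
    simpa using (tendsto_const_nhds (x := x)).sub this
  refine tendsto_of_tendsto_of_tendsto_of_le_of_le hp tendsto_const_nhds (fun m => ?_) fun m => ?_
  · have h2 : (0 : ℝ) < 2 ^ m := by positivity
    have h3 := Nat.le_ceil (x * 2 ^ m)
    have h4 : ((⌈x * 2 ^ m⌉₊ : ℕ) : ℝ) ≤ ((⌈x * 2 ^ m⌉₊ - 1 : ℕ) : ℝ) + 1 := by
      exact_mod_cast (by omega : ⌈x * 2 ^ m⌉₊ ≤ ⌈x * 2 ^ m⌉₊ - 1 + 1)
    simp only
    rw [sub_le_iff_le_add, ← add_div, le_div_iff₀ h2]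
    linarith
  · have h2 : (0 : ℝ) < 2 ^ m := by positivity
    have hx : 0 ≤ x * 2 ^ m := by positivity
    have h3 := Nat.ceil_lt_add_one hx
    simp only
    rw [div_le_iff₀ h2]
    rcases Nat.eq_zero_or_pos ⌈x * 2 ^ m⌉₊ with h | h
    · simpa [h] using hx
    · rw [Nat.cast_sub h]
      push_cast
      linarith

theorem isOpen_below (x : ℝ) : IsOpen (below x) := by
  have : below x = ⋃ m, {X | prefixOf X m ∈ {τ | ((val τ : ℝ) + 1) / 2 ^ m < x}} := by
    ext; simp [below]
  rw [this]
  exact isOpen_iUnion fun m => (isClopen_prefixOf _ m).isOpen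

/-- This keeps the padding disjoint from sets of sequences that begin with `true`. -/
theorem zero_of_mem_below {x : ℝ} (hx : x ≤ 2⁻¹) {X : Cantor} (hX : X ∈ below x) :
    X 0 = false := by
  obtain ⟨m, hm⟩ := hX
  by_contra h
  have hX0 : X 0 = true := by simpa using h
  refine absurd (hm.trans_le hx) (not_lt.2 ?_)
  rcases m with _ | m
  · simp [val]; norm_num
  · have : prefixOf X (m + 1) = true :: prefixOf (shift 1 X) m := by
      conv_lhs => rw [← cons_shift_one X, hX0]
      exact prefixOf_cons _ _ _
    rw [this, val_cons, length_prefixOf, le_div_iff₀ (by positivity)]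
    push_cast
    rw [pow_succ]
    have : (0 : ℝ) ≤ val (prefixOf (shift 1 X) m) := by positivity
    simp
    linarith

end

/-! ### Padding a spread test to exact measure: the Schnorr case -/

section

variable {O : Set (ℕ →. ℕ)} {α : Type} [Primcodable α]

theorem _root_.ComputableIn.any_range [Inhabited α] {P : α × ℕ → Bool} (hP : ComputableIn O P) :
    ComputableIn O fun p : α × ℕ => (List.range p.2).any fun e => P (p.1, e) := by
  have hq : Primrec fun p : α × ℕ => (List.range p.2).map fun e => (p.1, e) :=
    Primrec.list_map (Primrec.list_range.comp Primrec.snd)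
      ((Primrec.fst.comp Primrec.fst).pair Primrec.snd).to₂
  refine (ComputableIn.of_queries hP hq (h := fun _ l => l.any id)
    (Primrec.list_any_id.comp Primrec.snd).to₂).of_eq fun p => ?_
  simp [Function.comp_def]

theorem _root_.ComputableIn.all_range [Inhabited α] {P : α × ℕ → Bool} (hP : ComputableIn O P) :
    ComputableIn O fun p : α × ℕ => (List.range p.2).all fun e => P (p.1, e) :=
  (hP.not.any_range.not).of_eq fun p => by rw [List.not_any_eq_all_not]; simp

/-- The stage `s` of the part of a spread test that lies in `{X | X 0 = true}`. -/
def stage (C : ℕ → Str → Bool) (n s : ℕ) (τ : Str) : Bool :=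
  decide (τ.head? = some true) &&
    (List.range s).any fun e => C (n + 1 + 2 * e + 1) (str e ++ τ)

/-- At length `L`, the components of the test that contribute to stage `s` are exhausted up to a
measure that is small in comparison to `2⁻¹ ^ s`. -/
def exhausted (C : ℕ → Str → Bool) (n s L : ℕ) : Bool :=
  decide (1 ≤ L) && (List.range s).all fun e =>
    decide (2 ^ (L + (2 * e + s + 2)) ≤
      cnt (C (n + 1 + 2 * e + 1)) L * 2 ^ ((n + 1 + 2 * e + 1) + (2 * e + s + 2)) +
        2 ^ ((n + 1 + 2 * e + 1) + L))

theorem IsDecFamily.computable_stage {C : ℕ → Str → Bool} (hC : IsDecFamily O C) :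
    ComputableIn₂ O fun (p : ℕ × ℕ) τ => stage C p.1 p.2 τ := by
  have h := hC.computable_spread.any_range
  refine ComputableIn.and (Primrec.computableIn ?_) ?_
  · exact Primrec.eq.decide.comp (Primrec.list_head?.comp Primrec.snd) (Primrec.const _)
  · exact h.comp (g := fun q : (ℕ × ℕ) × Str => ((q.1.1 + 1, q.2), q.1.2))
      (((Primrec.succ.comp (Primrec.fst.comp Primrec.fst)).pair Primrec.snd).pair
        (Primrec.snd.comp Primrec.fst)).computableIn

theorem IsDecFamily.computable_exhausted {C : ℕ → Str → Bool} (hC : IsDecFamily O C) :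
    ComputableIn O fun p : (ℕ × ℕ) × ℕ => exhausted C p.1.1 p.1.2 p.2 := by
  have hcnt := ComputableIn₂.cnt hC.computable
  have hn : Primrec fun q : (ℕ × ℕ × ℕ) × ℕ => q.1.1 := Primrec.fst.comp Primrec.fst
  have hs : Primrec fun q : (ℕ × ℕ × ℕ) × ℕ => q.1.2.1 :=
    Primrec.fst.comp (Primrec.snd.comp Primrec.fst)
  have hL : Primrec fun q : (ℕ × ℕ × ℕ) × ℕ => q.1.2.2 :=
    Primrec.snd.comp (Primrec.snd.comp Primrec.fst)
  have he : Primrec fun q : (ℕ × ℕ × ℕ) × ℕ => 2 * q.2 := Primrec.nat_double.comp Primrec.snd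
  have hk : Primrec fun q : (ℕ × ℕ × ℕ) × ℕ => q.1.1 + 1 + 2 * q.2 + 1 :=
    Primrec.succ.comp (Primrec.nat_add.comp (Primrec.succ.comp hn) he)
  have ht : Primrec fun q : (ℕ × ℕ × ℕ) × ℕ => 2 * q.2 + q.1.2.1 + 2 :=
    Primrec.nat_add.comp (Primrec.nat_add.comp he hs) (Primrec.const 2)
  have hp : ∀ {f g : (ℕ × ℕ × ℕ) × ℕ → ℕ}, Primrec f → Primrec g →
      ComputableIn O fun q => 2 ^ (f q + g q) := fun hf hg =>
    (Primrec.nat_add.comp hf hg).computableIn.two_pow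
  have hP := (hp hL ht).decide_le
    (((hcnt.comp hk.computableIn hL.computableIn).mul (hp hk ht)).add (hp hk hL))
  refine ComputableIn.and (ComputableIn.decide_le (.const 1) .snd) ?_
  exact hP.all_range.comp (g := fun p : (ℕ × ℕ) × ℕ => ((p.1.1, p.1.2, p.2), p.1.2))
    (((Primrec.fst.comp Primrec.fst).pair ((Primrec.snd.comp Primrec.fst).pair Primrec.snd)).pair
      (Primrec.snd.comp Primrec.fst)).computableIn

/-- Clearing denominators gives the decidable form used in `exhausted`, with `k = n + 1 + 2 * e + 1`
and `t = 2 * e + s + 2`. -/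
theorem inv_two_pow_le_add_iff {k L t a : ℕ} : (2⁻¹ : ℝ≥0∞) ^ k ≤ 2⁻¹ ^ L * a + 2⁻¹ ^ t ↔
    2 ^ (L + t) ≤ a * 2 ^ (k + t) + 2 ^ (k + L) := by
  have h2 : (2⁻¹ : ℝ≥0∞) = ((2⁻¹ : ℝ≥0) : ℝ≥0∞) := by simp
  rw [h2]
  have h3 : ((2⁻¹ : ℝ≥0) : ℝ≥0∞) ^ k ≤ ((2⁻¹ : ℝ≥0) : ℝ≥0∞) ^ L * a + ((2⁻¹ : ℝ≥0) : ℝ≥0∞) ^ t ↔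
      (2⁻¹ : ℝ) ^ k ≤ 2⁻¹ ^ L * a + 2⁻¹ ^ t := by
    rw [← NNReal.coe_two, ← NNReal.coe_inv]
    exact_mod_cast Iff.rfl
  have hpos : (0 : ℝ) < 2 ^ k * 2 ^ L * 2 ^ t := by positivity
  have e1 : (2⁻¹ : ℝ) ^ k * (2 ^ k * 2 ^ L * 2 ^ t) = 2 ^ (L + t) := by
    rw [inv_pow]; field_simp; ring
  have e2 : ((2⁻¹ : ℝ) ^ L * a + 2⁻¹ ^ t) * (2 ^ k * 2 ^ L * 2 ^ t) =
      a * 2 ^ (k + t) + 2 ^ (k + L) := by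
    rw [inv_pow, inv_pow]; field_simp; ring
  rw [h3, ← mul_le_mul_iff_left₀ hpos, e1, e2]
  exact_mod_cast Iff.rfl

variable {C : ℕ → Str → Bool}

/-- The part of a spread test that lies in `{X | X 0 = true}`. -/
def half (C : ℕ → Str → Bool) (n : ℕ) : Set Cantor :=
  {X | X 0 = true} ∩ spread (fun n => hull (C n)) (n + 1)

theorem head?_prefixOf {X : Cantor} {m : ℕ} (hm : 1 ≤ m) : (prefixOf X m).head? = some (X 0) := by
  obtain ⟨m, rfl⟩ := Nat.exists_eq_add_of_le' hm
  rw [← cons_shift_one X, prefixOf_cons]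
  rfl

theorem half_of_stage (hC : ∀ n, Upward (C n)) {n s m : ℕ} {X : Cantor}
    (h : stage C n s (prefixOf X m) = true) : X ∈ half C n := by
  simp only [stage, Bool.and_eq_true, decide_eq_true_eq, List.any_eq_true, List.mem_range] at h
  obtain ⟨h1, e, -, he⟩ := h
  rcases m with _ | m
  · simp at h1
  · rw [head?_prefixOf (by omega)] at h1
    exact ⟨by simpa using h1, (mem_spread_hull hC).2 ⟨_, e, he⟩⟩

theorem mem_half_iff (hC : ∀ n, Upward (C n)) {n : ℕ} {X : Cantor} :
    X ∈ half C n ↔ ∃ m s, stage C n s (prefixOf X m) = true := by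
  refine ⟨fun ⟨h0, h⟩ => ?_, fun ⟨m, s, h⟩ => half_of_stage hC h⟩
  obtain ⟨m, e, he⟩ := (mem_spread_hull hC).1 h
  -- The prefix is lengthened by one because `stage` must read the first bit and `m` may be 0.
  refine ⟨m + 1, e + 1, ?_⟩
  simp only [stage, Bool.and_eq_true, decide_eq_true_eq, List.any_eq_true, List.mem_range]
  refine ⟨by rw [head?_prefixOf (by omega)]; exact congrArg some h0, e, by omega, ?_⟩
  exact hC _ _ _ ((List.prefix_append_right_inj _).2 (prefixOf_prefix X m.le_succ)) he

/-- What stage `s` at length `L` misses is of two kinds: the unseen rest of the components with `e <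
s` (`B₁`), and all components with `e ≥ s` (`B₂`). Each kind has measure at most `2⁻¹ ^ (s + 1)`.
Together with `exists_exhausted` this makes the measure of `half C n` computable in the oracle. -/
theorem lebesgue_half_le_of_exhausted (hC : ∀ n, Upward (C n))
    (hμ : ∀ n, lebesgue (hull (C n)) = (2⁻¹ : ℝ≥0∞) ^ n) {n s L : ℕ}
    (h : exhausted C n s L = true) :
    lebesgue (half C n) ≤ 2⁻¹ ^ L * cnt (stage C n s) L + 2⁻¹ ^ s := by
  simp only [exhausted, Bool.and_eq_true, decide_eq_true_eq, List.all_eq_true,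
    List.mem_range] at h
  obtain ⟨hL, h⟩ := h
  let 𝒰 : ℕ → Set Cantor := fun n => hull (C n)
  let D : ℕ → Set Cantor := fun e => {X | C (n + 1 + 2 * e + 1) (prefixOf X L) = true}
  let B₁ : ℕ → Set Cantor := fun e =>
    if e < s then app (str e) ⁻¹' (𝒰 (n + 1 + 2 * e + 1) \ D e) else ∅
  let B₂ : ℕ → Set Cantor := fun i => app (str (s + i)) ⁻¹' 𝒰 (n + 1 + 2 * (s + i) + 1)
  have hsub : half C n ⊆ {X | stage C n s (prefixOf X L) = true} ∪ ((⋃ e, B₁ e) ∪ ⋃ i, B₂ i) := by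
    rintro X ⟨h0, hX⟩
    obtain ⟨e, he⟩ := Set.mem_iUnion.1 hX
    rcases lt_or_ge e s with hes | hes
    · by_cases hD : app (str e) X ∈ D e
      · refine Or.inl ?_
        simp only [stage, Bool.and_eq_true, decide_eq_true_eq, List.any_eq_true, List.mem_range,
          Set.mem_ofPred_eq]
        refine ⟨by rw [head?_prefixOf hL]; exact congrArg some h0, e, hes, ?_⟩
        rw [← prefixOf_app]
        exact mem_prefixOf_mono (hC _) (by omega) hD
      · refine Or.inr (Or.inl (Set.mem_iUnion.2 ⟨e, ?_⟩))
        simp only [B₁, if_pos hes]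
        exact ⟨he, hD⟩
    · obtain ⟨i, rfl⟩ := Nat.exists_eq_add_of_le hes
      exact Or.inr (Or.inr (Set.mem_iUnion.2 ⟨i, he⟩))
  have h𝒰m : ∀ k, MeasurableSet (𝒰 k) := fun k => measurableSet_hull _
  have hB₁ : lebesgue (⋃ e, B₁ e) ≤ 2⁻¹ ^ (s + 1) := by
    refine (measure_iUnion_le _).trans ((ENNReal.tsum_le_tsum fun e => ?_).trans
      (tsum_inv_two_pow (s + 1)).le)
    by_cases hes : e < s
    · simp only [B₁, if_pos hes]
      have hDm : MeasurableSet (D e) := measurableSet_prefixOf _ _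
      have hDsub : D e ⊆ 𝒰 (n + 1 + 2 * e + 1) := fun X hX => ⟨L, hX⟩
      -- After dilation by `2 ^ e` this leaves `2⁻¹ ^ (e + s + 2)`, which sums over `e` to `2⁻¹ ^ (s
      -- + 1)`.
      have hdiff : lebesgue (𝒰 (n + 1 + 2 * e + 1) \ D e) ≤ 2⁻¹ ^ (2 * e + s + 2) := by
        rw [measure_sdiff hDsub hDm.nullMeasurableSet (measure_ne_top _ _), hμ,
          lebesgue_prefixOf, tsub_le_iff_left]
        exact inv_two_pow_le_add_iff.2 (h e hes)
      calc _ ≤ 2 ^ e * lebesgue (𝒰 (n + 1 + 2 * e + 1) \ D e) :=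
            lebesgue_app_str_le ((h𝒰m _).diff hDm) e
        _ ≤ 2 ^ e * 2⁻¹ ^ ((s + 1 + 1 + e) + e) := by
            gcongr
            exact hdiff.trans (le_of_eq (by congr 1; omega))
        _ = _ := two_pow_mul_inv_two_pow _ _
    · simp [B₁, hes]
  have hB₂ : lebesgue (⋃ i, B₂ i) ≤ 2⁻¹ ^ (s + 1) := by
    refine (measure_iUnion_le _).trans ((ENNReal.tsum_le_tsum fun i => ?_).trans
      (tsum_inv_two_pow (s + 1)).le)
    refine (lebesgue_app_test_le h𝒰m (fun k => (hμ k).le) (n + 1) (s + i)).trans ?_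
    exact pow_le_pow_right_of_le_one' (by simp) (by omega)
  calc lebesgue (half C n) ≤ _ := measure_mono hsub
    _ ≤ 2⁻¹ ^ L * cnt (stage C n s) L + (2⁻¹ ^ (s + 1) + 2⁻¹ ^ (s + 1)) := by
      refine (measure_union_le _ _).trans (add_le_add (lebesgue_prefixOf _ _).le ?_)
      exact (measure_union_le _ _).trans (add_le_add hB₁ hB₂)
    _ = _ := by
      rw [← two_mul, pow_succ', ← mul_assoc, ENNReal.mul_inv_cancel (by simp) (by simp), one_mul]

/-- The measure of each component is known exactly, so its clopen approximations eventually come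
within any positive error, and only finitely many `e` matter. -/
theorem exists_exhausted (hC : ∀ n, Upward (C n))
    (hμ : ∀ n, lebesgue (hull (C n)) = (2⁻¹ : ℝ≥0∞) ^ n) (n s : ℕ) :
    ∃ L, exhausted C n s L = true := by
  simp only [exhausted, Bool.and_eq_true, decide_eq_true_eq, List.all_eq_true, List.mem_range]
  have h : ∀ᶠ L in atTop, ∀ e ∈ Finset.range s, 2 ^ (L + (2 * e + s + 2)) ≤
      cnt (C (n + 1 + 2 * e + 1)) L * 2 ^ ((n + 1 + 2 * e + 1) + (2 * e + s + 2)) +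
        2 ^ ((n + 1 + 2 * e + 1) + L) := by
    rw [Filter.eventually_all_finset]
    intro e _
    have ht := (tendsto_lebesgue_hull (hC (n + 1 + 2 * e + 1))).add_const
      ((2⁻¹ : ℝ≥0∞) ^ (2 * e + s + 2))
    simp only [hμ, lebesgue_prefixOf] at ht
    refine (ht.eventually (lt_mem_nhds (ENNReal.lt_add_right (by finiteness) ?_))).mono
      fun L hL => inv_two_pow_le_add_iff.1 hL.le
    exact (ENNReal.pow_pos (by simp) _).ne'
  obtain ⟨L, h1, h2⟩ := ((eventually_ge_atTop 1).and h).exists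
  exact ⟨L, h1, fun e he => h2 e (Finset.mem_range.2 he)⟩

/-- What `half C n` lacks to have measure `2⁻¹ ^ n`. -/
noncomputable def deficit (C : ℕ → Str → Bool) (n : ℕ) : ℝ := 2⁻¹ ^ n - lebesgue.real (half C n)

/-- The decidable condition by which `below (deficit C n)` is enumerated. -/
def belowStage (C : ℕ → Str → Bool) (n s L : ℕ) (σ : Str) : Bool :=
  exhausted C n s L && decide ((val σ + 1) * 2 ^ (L + (s + n)) +
    cnt (stage C n s) L * 2 ^ (σ.length + (s + n)) + 2 ^ (σ.length + (L + n)) + 1 ≤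
      2 ^ (σ.length + (L + s)))

/-- Both sides are multiplied by the common denominator; the `+ 1 ≤` in `belowStage` is strict
inequality of natural numbers. -/
theorem belowStage_iff {n s L : ℕ} {σ : Str} : belowStage C n s L σ = true ↔
    exhausted C n s L = true ∧
      ((val σ : ℝ) + 1) / 2 ^ σ.length + cnt (stage C n s) L / 2 ^ L + 2⁻¹ ^ s < 2⁻¹ ^ n := by
  simp only [belowStage, Bool.and_eq_true, decide_eq_true_eq, Nat.succ_le_iff]
  refine and_congr_right fun _ => ?_
  generalize cnt (stage C n s) L = a
  generalize val σ = v
  generalize σ.length = m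
  have hpos : (0 : ℝ) < 2 ^ m * 2 ^ L * 2 ^ s * 2 ^ n := by positivity
  have e1 : (((v : ℝ) + 1) / 2 ^ m + a / 2 ^ L + 2⁻¹ ^ s) * (2 ^ m * 2 ^ L * 2 ^ s * 2 ^ n) =
      (v + 1) * 2 ^ (L + (s + n)) + a * 2 ^ (m + (s + n)) + 2 ^ (m + (L + n)) := by
    rw [inv_pow]; field_simp; ring
  have e2 : (2⁻¹ : ℝ) ^ n * (2 ^ m * 2 ^ L * 2 ^ s * 2 ^ n) = 2 ^ (m + (L + s)) := by
    rw [inv_pow]; field_simp; ring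
  rw [← mul_lt_mul_iff_left₀ hpos, e1, e2]
  exact_mod_cast Iff.rfl

theorem lebesgue_real_prefixOf (c : Str → Bool) (m : ℕ) :
    lebesgue.real {X | c (prefixOf X m) = true} = cnt c m / 2 ^ m := by
  rw [Measure.real, lebesgue_prefixOf, ENNReal.toReal_mul, ENNReal.toReal_pow]
  simp [div_eq_inv_mul]

/-- A strict inequality against the deficit leaves a gap larger than some `2⁻¹ ^ s`, hence is
witnessed by an upper bound for the measure of `half C n` with error `2⁻¹ ^ s`. -/
theorem mem_below_deficit_iff (hC : ∀ n, Upward (C n))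
    (hμ : ∀ n, lebesgue (hull (C n)) = (2⁻¹ : ℝ≥0∞) ^ n) {n : ℕ} {X : Cantor} :
    X ∈ below (deficit C n) ↔ ∃ m s L, belowStage C n s L (prefixOf X m) = true := by
  simp only [below, deficit, Set.mem_ofPred_eq, belowStage_iff, length_prefixOf]
  refine exists_congr fun m => ⟨fun h => ?_, fun ⟨s, L, h1, h2⟩ => ?_⟩
  · obtain ⟨s, hs⟩ := exists_pow_lt_of_lt_one (sub_pos.2 h) (by norm_num : (2⁻¹ : ℝ) < 1)
    obtain ⟨L, hL⟩ := exists_exhausted hC hμ n s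
    refine ⟨s, L, hL, ?_⟩
    have : (cnt (stage C n s) L : ℝ) / 2 ^ L ≤ lebesgue.real (half C n) := by
      rw [← lebesgue_real_prefixOf]
      exact measureReal_mono fun X hX => half_of_stage hC hX
    linarith
  · have := lebesgue_half_le_of_exhausted hC hμ h1
    rw [← lebesgue_prefixOf] at this
    have h3 := ENNReal.toReal_mono (by finiteness) this
    rw [ENNReal.toReal_add (by finiteness) (by finiteness)] at h3
    change lebesgue.real (half C n) ≤ lebesgue.real _ + _ at h3
    rw [lebesgue_real_prefixOf] at h3
    simp only [ENNReal.toReal_pow, ENNReal.toReal_inv, ENNReal.toReal_ofNat] at h3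
    linarith

/-- A test with measures exactly `2⁻¹ ^ n` that covers `half C n`. -/
noncomputable def padded (C : ℕ → Str → Bool) : ℕ → Set Cantor
  | 0 => Set.univ
  | n + 1 => half C (n + 1) ∪ below (deficit C (n + 1))

theorem half_subset_padded (n : ℕ) : half C n ⊆ padded C n := by
  cases n with
  | zero => exact Set.subset_univ _
  | succ n => exact Set.subset_union_left

theorem isOpen_padded (n : ℕ) : IsOpen (padded C n) := by
  cases n with
  | zero => exact isOpen_univ
  | succ n =>
    exact (((isClopen_discrete {true}).preimage (continuous_apply 0)).isOpen.inter
      (isOpen_spread (fun _ => isOpen_hull _) _)).union (isOpen_below _)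

theorem lebesgue_real_half_le (hμ : ∀ n, lebesgue (hull (C n)) = (2⁻¹ : ℝ≥0∞) ^ n) (n : ℕ) :
    lebesgue.real (half C n) ≤ 2⁻¹ ^ (n + 1) := by
  have h : lebesgue (half C n) ≤ 2⁻¹ ^ (n + 1) := (measure_mono Set.inter_subset_right).trans
    (lebesgue_spread_le (fun _ => measurableSet_hull _) (fun k => (hμ k).le) (n + 1))
  have := ENNReal.toReal_mono (by finiteness) h
  simpa [Measure.real] using this

/-- The shift of index in `half` gives it measure at most `2⁻¹ ^ (n + 1)`, half of what is allowed.
Hence the deficit at `n` is at least `2⁻¹ ^ (n + 1)`, which bounds the deficit at `n + 1`, so the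
padding decreases along with the test. For positive `n` the deficit is at most `2⁻¹` and the padding
stays among sequences that begin with `false`; component 0 must have full measure and is taken to be
the whole space. -/
theorem IsDecFamily.isSchnorrTest_padded (hC : IsDecFamily O C)
    (hμ : ∀ n, lebesgue (hull (C n)) = (2⁻¹ : ℝ≥0∞) ^ n)
    (hanti : Antitone fun n => hull (C n)) : IsSchnorrTest O (padded C) := by
  refine ⟨?_, antitone_nat_of_succ_le fun n => ?_, fun n => ?_⟩
  · refine uniformlyCEOpen_of_rel (R := fun q => (decide (q.1.1 = 0) ||
      stage C q.1.1 q.2.unpair.1 q.1.2) ||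
        belowStage C q.1.1 q.2.unpair.1 q.2.unpair.2 q.1.2) ?_ ?_
    · have hn : Primrec fun q : (ℕ × Str) × ℕ => q.1.1 := Primrec.fst.comp Primrec.fst
      have hs : Primrec fun q : (ℕ × Str) × ℕ => q.2.unpair.1 :=
        Primrec.fst.comp (Primrec.unpair.comp Primrec.snd)
      have hL : Primrec fun q : (ℕ × Str) × ℕ => q.2.unpair.2 :=
        Primrec.snd.comp (Primrec.unpair.comp Primrec.snd)
      have hσ : Primrec fun q : (ℕ × Str) × ℕ => q.1.2 := Primrec.snd.comp Primrec.fst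
      have hm : Primrec fun q : (ℕ × Str) × ℕ => q.1.2.length := Primrec.list_length.comp hσ
      have hp : ∀ {f g h : (ℕ × Str) × ℕ → ℕ}, Primrec f → Primrec g → Primrec h →
          ComputableIn O fun q => 2 ^ (f q + (g q + h q)) := fun hf hg hh =>
        (Primrec.nat_add.comp hf (Primrec.nat_add.comp hg hh)).computableIn.two_pow
      have h1 : ComputableIn O fun q : (ℕ × Str) × ℕ => decide (q.1.1 = 0) :=
        (Primrec.eq.decide.comp hn (Primrec.const 0)).computableIn
      have h2 := hC.computable_stage.comp (hn.pair hs).computableIn hσ.computableIn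
      have h3 := hC.computable_exhausted.comp ((hn.pair hs).pair hL).computableIn
      have h4 := (ComputableIn₂.cnt hC.computable_stage).comp (hn.pair hs).computableIn
        hL.computableIn
      have h5 := (((((Primrec.succ.comp (primrec_val.comp hσ)).computableIn.mul
        (hp hL hs hn)).add (h4.mul (hp hm hs hn))).add (hp hm hL hn)).add (.const 1)).decide_le
          (hp hm hL hs)
      exact (h1.or h2).or (h3.and h5)
    · intro n X
      simp only [Bool.or_eq_true, decide_eq_true_eq]
      rcases n with _ | n
      · exact ⟨fun _ => ⟨0, 0, by simp⟩, fun _ => trivial⟩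
      · simp only [padded, Set.mem_union, mem_half_iff hC.upward,
          mem_below_deficit_iff hC.upward hμ]
        constructor
        · rintro (⟨m, s, h⟩ | ⟨m, s, L, h⟩)
          · exact ⟨m, Nat.pair s 0, by simp [h]⟩
          · exact ⟨m, Nat.pair s L, by simp [h]⟩
        · rintro ⟨m, b, (h | h) | h⟩
          · omega
          · exact Or.inl ⟨m, _, h⟩
          · exact Or.inr ⟨m, _, _, h⟩
  · rcases n with _ | n
    · exact Set.subset_univ _
    · refine Set.union_subset_union (Set.inter_subset_inter_right _
        (antitone_spread hanti (Nat.le_succ _))) (below_mono ?_)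
      have h1 := lebesgue_real_half_le hμ (n + 1)
      have h2 : 0 ≤ lebesgue.real (half C (n + 2)) := measureReal_nonneg
      simp only [deficit]
      have h3 : (2⁻¹ : ℝ) ^ (n + 1) = 2 * 2⁻¹ ^ (n + 1 + 1) := by rw [pow_succ _ (n + 1)]; ring
      linarith
  · rcases n with _ | n
    · simp [padded]
    · have h1 := lebesgue_real_half_le hμ (n + 1)
      have h3 : (2⁻¹ : ℝ) ^ (n + 1) = 2 * 2⁻¹ ^ (n + 1 + 1) := by rw [pow_succ _ (n + 1)]; ring
      have h4 : (0 : ℝ) < 2⁻¹ ^ (n + 1 + 1) := by positivity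
      have h0 : 0 ≤ lebesgue.real (half C (n + 1)) := measureReal_nonneg
      have hd0 : 0 ≤ deficit C (n + 1) := by simp only [deficit]; linarith
      have h5 : (2⁻¹ : ℝ) ^ (n + 1) ≤ 2⁻¹ := pow_le_of_le_one (by norm_num) (by norm_num) (by omega)
      have hd1 : deficit C (n + 1) ≤ 2⁻¹ := by simp only [deficit]; linarith
      have hdisj : Disjoint (half C (n + 1)) (below (deficit C (n + 1))) := by
        refine Set.disjoint_left.2 fun X hX hX' => ?_
        have : X 0 = true := hX.1
        rw [zero_of_mem_below hd1 hX'] at this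
        cases this
      rw [padded, measure_union hdisj (isOpen_below _).measurableSet,
        lebesgue_below hd0 (hd1.trans (by norm_num)), ← ofReal_measureReal,
        ← ENNReal.ofReal_add h0 hd0, deficit, add_sub_cancel, ENNReal.ofReal_pow (by norm_num)]
      congr 1
      rw [ENNReal.ofReal_inv_of_pos two_pos, ENNReal.ofReal_ofNat]

theorem MLR_subset_SR_of_W2R_subset (hO : TotalOracles O) (h : W2R ∅ ⊆ SR O) :
    MLR ∅ ⊆ SR O := by
  refine MLR_subset_of_W2R_subset h fun Z hZ => ?_
  simp only [SR, Set.mem_ofPred_eq, not_forall, not_not] at hZ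
  obtain ⟨𝒰, ⟨h1, h2, h3⟩, hZ⟩ := hZ
  obtain ⟨C, hC, hU⟩ := h1.exists_isDecFamily hO
  obtain rfl : 𝒰 = fun n => hull (C n) := funext hU
  refine ⟨padded C, isOpen_padded, fun n k hk => half_subset_padded n ⟨hk, shift_mem_spread hZ _ k⟩,
    fun Y _ hY hYR => hYR _ (hC.isSchnorrTest_padded h3 h2) (Set.mem_iInter.2 hY)⟩

end

/-! ### Mixed martingales: the computable randomness case -/

section

variable {O : Set (ℕ →. ℕ)}

theorem IsMartingale.le {d : Str → ℝ≥0} (hd : IsMartingale d) (σ : Str) :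
    d σ ≤ 2 ^ σ.length * d [] := by
  induction σ using List.reverseRecOn with
  | nil => simp
  | append_singleton σ b ih =>
    have h1 : d (σ ++ [b]) ≤ 2 * d σ := by
      rw [hd σ, mul_div_cancel₀ _ two_ne_zero]
      cases b
      · exact le_self_add
      · exact le_add_self
    calc d (σ ++ [b]) ≤ 2 * (2 ^ σ.length * d []) := h1.trans (by gcongr)
      _ = _ := by simp [pow_succ']; ring

/-- A martingale that succeeds on all tails of the sequences on which `d` succeeds. -/
noncomputable def mix (d : Str → ℝ≥0) (τ : Str) : ℝ≥0 := ∑' e, 4⁻¹ ^ (e + 1) * d (str e ++ τ)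

/-- A martingale at most doubles with each bit, so prepending `str e` costs at most `2 ^ e`. The
weight `4⁻¹ ^ (e + 1)` absorbs this and still leaves a geometric series. -/
theorem IsMartingale.mix_term_le {d : Str → ℝ≥0} (hd : IsMartingale d) (τ : Str) (e : ℕ) :
    4⁻¹ ^ (e + 1) * d (str e ++ τ) ≤ 2 ^ τ.length * d [] * 2⁻¹ ^ (e + 2) := by
  have h1 : d (str e ++ τ) ≤ 2 ^ (e + τ.length) * d [] := (hd.le _).trans (by
    gcongr
    · norm_num
    · simpa using length_str_le e)
  have h2 : (4⁻¹ : ℝ≥0) ^ (e + 1) = 2⁻¹ ^ (e + 2) * 2⁻¹ ^ e := by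
    have : (4⁻¹ : ℝ≥0) = 2⁻¹ ^ 2 := by rw [inv_pow]; norm_num
    rw [this, ← pow_mul, ← pow_add]
    congr 1
    ring
  have h3 : (2⁻¹ : ℝ≥0) ^ e * 2 ^ e = 1 := by rw [← mul_pow]; simp
  calc _ ≤ 2⁻¹ ^ (e + 2) * 2⁻¹ ^ e * (2 ^ (e + τ.length) * d []) := by rw [h2]; gcongr
    _ = 2 ^ τ.length * d [] * 2⁻¹ ^ (e + 2) * (2⁻¹ ^ e * 2 ^ e) := by rw [pow_add]; ring
    _ = _ := by rw [h3, mul_one]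

theorem IsMartingale.summable_mix {d : Str → ℝ≥0} (hd : IsMartingale d) (τ : Str) :
    Summable fun e => 4⁻¹ ^ (e + 1) * d (str e ++ τ) := by
  refine NNReal.summable_of_le (hd.mix_term_le τ) (Summable.mul_left _ ?_)
  have : Summable fun e : ℕ => (2⁻¹ : ℝ≥0) ^ e := NNReal.summable_geometric (by
    rw [← NNReal.coe_lt_coe]; norm_num)
  exact (this.mul_right (2⁻¹ ^ 2)).congr fun e => by rw [pow_add]

theorem IsMartingale.mix {d : Str → ℝ≥0} (hd : IsMartingale d) : IsMartingale (mix d) := by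
  intro σ
  simp only [Randomness.mix]
  rw [← (hd.summable_mix _).tsum_add (hd.summable_mix _), ← tsum_div_const]
  refine tsum_congr fun e => ?_
  rw [hd (str e ++ σ), List.append_assoc, List.append_assoc]
  ring

/-- The value at `4` of the polynomial with the given coefficients, leading coefficient first. -/
def horner (l : List ℕ) : ℕ := l.foldl (fun s v => 4 * s + v) 0

theorem horner_map_range (v : ℕ → ℕ) (N : ℕ) : (horner ((List.range N).map v) : ℝ) / 4 ^ N =
    ∑ e ∈ Finset.range N, (4⁻¹ : ℝ) ^ (e + 1) * v e := by
  induction N with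
  | zero => simp [horner]
  | succ N ih =>
    rw [Finset.sum_range_succ, ← ih, List.range_succ, List.map_append, horner, List.foldl_append]
    simp only [List.map_cons, List.map_nil, List.foldl_cons, List.foldl_nil]
    change ((4 * horner _ + v N : ℕ) : ℝ) / _ = _
    push_cast
    rw [inv_pow, pow_succ]
    field_simp

theorem abs_sub_round_div_le (S D n : ℕ) (hD : 0 < D) :
    |(S : ℝ) / D - (((2 * (S * 2 ^ n) + D) / (2 * D) : ℕ) : ℝ) / 2 ^ n| ≤ 2⁻¹ ^ n / 2 := by
  set q := (2 * (S * 2 ^ n) + D) / (2 * D) with hq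
  have h1 : q * (2 * D) ≤ 2 * (S * 2 ^ n) + D := Nat.div_mul_le_self _ _
  have h2 : 2 * (S * 2 ^ n) + D < (q + 1) * (2 * D) := by
    have := Nat.lt_div_mul_add (a := 2 * (S * 2 ^ n) + D) (b := 2 * D) (by positivity)
    rw [add_mul, one_mul]
    exact this
  have h1' : (q : ℝ) * (2 * D) ≤ 2 * (S * 2 ^ n) + D := by exact_mod_cast h1
  have h2' : 2 * ((S : ℝ) * 2 ^ n) + D < (q + 1) * (2 * D) := by exact_mod_cast h2
  have hD' : (0 : ℝ) < D := by exact_mod_cast hD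
  have hn : (0 : ℝ) < 2 ^ n := by positivity
  have e : (S : ℝ) / D - q / 2 ^ n = (S * 2 ^ n - q * D) / (D * 2 ^ n) := by field_simp
  have e2 : (2⁻¹ : ℝ) ^ n / 2 = (D / 2) / (D * 2 ^ n) := by rw [inv_pow]; field_simp
  rw [e, abs_div, abs_of_pos (mul_pos hD' hn), e2]
  gcongr
  rw [abs_le]
  constructor <;> nlinarith

/-- The error `2⁻¹ ^ n` is shared out: at most `1/8` of it for cutting off the series, `1/4` for
approximating the values of `d`, and `1/2` for rounding to a multiple of `2⁻¹ ^ n`. -/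
theorem ComputableRealIn.mix {d : Str → ℝ≥0} (hm : IsMartingale d) (hd : ComputableRealIn O d) :
    ComputableRealIn O (mix d) := by
  obtain ⟨a, ha, had⟩ := hd
  obtain ⟨c, hc⟩ : ∃ c : ℕ, d [] ≤ 2 ^ c := by
    obtain ⟨c, hc⟩ := pow_unbounded_of_one_lt (d []) (one_lt_two)
    exact ⟨c, hc.le⟩
  -- With this cut-off, the bound `2 ^ τ.length * 2 ^ c` is cancelled and the tail is at most `2⁻¹ ^
  -- n / 8`. `S / D` is the partial sum over a common denominator.
  let N : Str × ℕ → ℕ := fun q => q.1.length + c + q.2 + 2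
  let S : Str × ℕ → ℕ := fun q =>
    horner ((List.range (N q)).map fun e => a (str e ++ q.1) (q.2 + 2))
  let D : Str × ℕ → ℕ := fun q => 4 ^ N q * 2 ^ (q.2 + 2)
  refine ⟨fun τ n => (2 * (S (τ, n) * 2 ^ n) + D (τ, n)) / (2 * D (τ, n)), ?_, fun τ n => ?_⟩
  · have hN : Primrec N := Primrec.nat_add.comp (Primrec.nat_add.comp (Primrec.nat_add.comp
      (Primrec.list_length.comp Primrec.fst) (Primrec.const c)) Primrec.snd) (Primrec.const 2)
    have hp : Primrec fun q : Str × ℕ => q.2 + 2 :=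
      Primrec.nat_add.comp Primrec.snd (Primrec.const 2)
    have hD : Primrec D := Primrec.nat_mul.comp (Primrec.nat_pow'.comp (Primrec.const 4) hN)
      (Primrec.nat_pow'.comp (Primrec.const 2) hp)
    have hS : ComputableIn O S := by
      have hq : Primrec fun q : Str × ℕ =>
          (List.range (N q)).map fun e => (str e ++ q.1, q.2 + 2) :=
        Primrec.list_map (Primrec.list_range.comp hN) ((Primrec.list_append.comp
          (primrec_str.comp Primrec.snd) (Primrec.fst.comp Primrec.fst)).pair
            (hp.comp Primrec.fst)).to₂
      have hh : Primrec horner := Primrec.list_foldl (α := List ℕ)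
        (h := fun (_ : List ℕ) (p : ℕ × ℕ) => 4 * p.1 + p.2) Primrec.id (Primrec.const 0)
        (Primrec.nat_add.comp (Primrec.nat_mul.comp (Primrec.const 4)
          (Primrec.fst.comp Primrec.snd)) (Primrec.snd.comp Primrec.snd)).to₂
      refine (ComputableIn.of_queries ha hq (h := fun _ l => horner l)
        (hh.comp Primrec.snd).to₂).of_eq fun q => ?_
      simp only [S, List.map_map]
      rfl
    exact ComputableIn₂.comp Primrec.nat_div.computableIn₂ ((ComputableIn.mul (.const 2)
      (hS.mul (ComputableIn.two_pow .snd))).add hD.computableIn)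
        (ComputableIn.mul (.const 2) hD.computableIn)
  · set f : ℕ → ℝ := fun e => 4⁻¹ ^ (e + 1) * (d (str e ++ τ) : ℝ) with hf
    have hsum : Summable f := by
      have := NNReal.summable_coe.2 (hm.summable_mix τ)
      simpa [hf] using this
    have hmix : ((Randomness.mix d τ : ℝ≥0) : ℝ) = ∑' e, f e := by
      simp [Randomness.mix, NNReal.coe_tsum, hf]
    have hfnn : ∀ e, 0 ≤ f e := fun e => by positivity
    have hNval : N (τ, n) = τ.length + c + n + 2 := rfl
    have htail : ∑' e, f (e + N (τ, n)) ≤ 2⁻¹ ^ n / 8 := by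
      have hg : HasSum (fun e : ℕ => (2⁻¹ : ℝ) ^ n / 16 * 2⁻¹ ^ e) (2⁻¹ ^ n / 8) := by
        have := (hasSum_geometric_of_lt_one (r := (2⁻¹ : ℝ)) (by norm_num) (by norm_num)).mul_left
          (2⁻¹ ^ n / 16)
        have h8 : (2⁻¹ : ℝ) ^ n / 16 * (1 - 2⁻¹)⁻¹ = 2⁻¹ ^ n / 8 := by ring
        rwa [h8] at this
      refine (Summable.tsum_le_tsum (fun e => ?_) ((summable_nat_add_iff _).2 hsum)
        hg.summable).trans hg.tsum_eq.le
      have h1 : f (e + N (τ, n)) ≤ 2 ^ τ.length * (d [] : ℝ) * 2⁻¹ ^ (e + N (τ, n) + 2) := by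
        have := NNReal.coe_le_coe.2 (hm.mix_term_le τ (e + N (τ, n)))
        simpa [hf] using this
      have h2 : (d [] : ℝ) ≤ 2 ^ c := by exact_mod_cast hc
      calc f (e + N (τ, n)) ≤ 2 ^ τ.length * 2 ^ c * 2⁻¹ ^ (e + N (τ, n) + 2) :=
            h1.trans (by gcongr)
        _ = _ := by
          rw [hNval]
          simp only [pow_add, inv_pow]
          field_simp
          norm_num
    have hpart : |∑ e ∈ Finset.range (N (τ, n)), f e - (S (τ, n) : ℝ) / D (τ, n)| ≤
        2⁻¹ ^ n / 4 := by
      have e1 : (S (τ, n) : ℝ) / D (τ, n) = ∑ e ∈ Finset.range (N (τ, n)),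
          4⁻¹ ^ (e + 1) * ((a (str e ++ τ) (n + 2) : ℝ) / 2 ^ (n + 2)) := by
        simp only [D, S]
        push_cast
        rw [← div_div, horner_map_range, Finset.sum_div]
        exact Finset.sum_congr rfl fun e _ => by ring
      rw [e1, ← Finset.sum_sub_distrib]
      refine (Finset.abs_sum_le_sum_abs _ _).trans ?_
      have h4 : ∀ k : ℕ, ∑ e ∈ Finset.range k, (4⁻¹ : ℝ) ^ (e + 1) ≤ 1 - 4⁻¹ ^ k := by
        intro k
        induction k with
        | zero => simp
        | succ k ih =>
          rw [Finset.sum_range_succ]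
          have : (0 : ℝ) ≤ 4⁻¹ ^ k := by positivity
          rw [pow_succ] at *
          linarith
      calc _ ≤ ∑ e ∈ Finset.range (N (τ, n)), (4⁻¹ : ℝ) ^ (e + 1) * 2⁻¹ ^ (n + 2) := by
            refine Finset.sum_le_sum fun e _ => ?_
            rw [hf, ← mul_sub, abs_mul, abs_of_pos (by positivity)]
            gcongr
            exact had _ _
        _ ≤ 1 * 2⁻¹ ^ (n + 2) := by
            rw [← Finset.sum_mul]
            gcongr
            exact (h4 _).trans (by simp)
        _ = _ := by rw [pow_add]; ring
    have hround := abs_sub_round_div_le (S (τ, n)) (D (τ, n)) n (by positivity)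
    have hsplit := hsum.sum_add_tsum_nat_add (N (τ, n))
    have htail0 : 0 ≤ ∑' e, f (e + N (τ, n)) := tsum_nonneg fun e => hfnn _
    rw [hmix, ← hsplit]
    simp only [abs_le] at hpart hround ⊢
    constructor <;> linarith [hpart.1, hpart.2, hround.1, hround.2]

/-- Finitely many values are bounded by their sum, so values exceeding any bound occur arbitrarily
late. -/
theorem succeeds_of_unbounded {d : Str → ℝ≥0} {X : Cantor}
    (h : ∀ n : ℕ, ∃ m, (n : ℝ≥0) < d (prefixOf X m)) : Succeeds d X := by
  refine ENNReal.eq_top_of_forall_nnreal_le fun r => ?_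
  refine le_limsup_of_frequently_le (frequently_atTop.2 fun k => ?_)
  obtain ⟨n, hn⟩ := exists_nat_ge (r + ∑ i ∈ Finset.range k, d (prefixOf X i))
  obtain ⟨m, hm⟩ := h n
  refine ⟨m, ?_, ENNReal.coe_le_coe.2 (le_self_add.trans (hn.trans hm.le))⟩
  by_contra! hmk
  have h1 : d (prefixOf X m) ≤ ∑ i ∈ Finset.range k, d (prefixOf X i) :=
    Finset.single_le_sum (f := fun i => d (prefixOf X i)) (fun _ _ => zero_le)
      (Finset.mem_range.2 hmk)
  exact absurd ((h1.trans le_add_self).trans hn) (not_le.2 hm)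

/-- The single term of the mixture belonging to `prefixOf Z k` follows `d` along `Z` itself, up to a
fixed positive factor. -/
theorem Succeeds.mix_shift {d : Str → ℝ≥0} (hd : IsMartingale d) {Z : Cantor}
    (hZ : Succeeds d Z) (k n : ℕ) : ∃ m, (n : ℝ≥0) < mix d (prefixOf (shift k Z) m) := by
  set e := Encodable.encode (prefixOf Z k)
  have hlt : (((n : ℝ≥0) * 4 ^ (e + 1) : ℝ≥0) : ℝ≥0∞) <
      limsup (fun n => (d (prefixOf Z n) : ℝ≥0∞)) atTop := by
    rw [show limsup (fun n => (d (prefixOf Z n) : ℝ≥0∞)) atTop = ⊤ from hZ]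
    exact ENNReal.coe_lt_top
  have hfreq := frequently_lt_of_lt_limsup (by isBoundedDefault) hlt
  obtain ⟨l, hl, hdl⟩ := frequently_atTop.1 hfreq k
  obtain ⟨m, rfl⟩ := Nat.exists_eq_add_of_le hl
  refine ⟨m, ?_⟩
  have h1 : 4⁻¹ ^ (e + 1) * d (str e ++ prefixOf (shift k Z) m) ≤
      mix d (prefixOf (shift k Z) m) := (hd.summable_mix _).le_tsum e fun _ _ => zero_le
  rw [str_encode, ← prefixOf_add] at h1
  refine lt_of_lt_of_le ?_ h1
  rw [inv_pow, ← div_eq_inv_mul, lt_div_iff₀ (by positivity)]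
  exact ENNReal.coe_lt_coe.1 hdl

/-- The open sets say that the mixed martingale exceeds `n` somewhere along the sequence; a point
common to all of them is one on which it succeeds. -/
theorem MLR_subset_CR_of_W2R_subset (h : W2R ∅ ⊆ CR O) : MLR ∅ ⊆ CR O := by
  refine MLR_subset_of_W2R_subset h fun Z hZ => ?_
  simp only [CR, Set.mem_ofPred_eq, not_forall, not_not] at hZ
  obtain ⟨d, hm, hc, hZ⟩ := hZ
  refine ⟨fun n => {X | ∃ m, (n : ℝ≥0) < mix d (prefixOf X m)}, fun n => ?_,
    fun n k _ => hZ.mix_shift hm k n,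
    fun Y _ hY hYR => hYR _ hm.mix (hc.mix hm) (succeeds_of_unbounded hY)⟩
  have : {X | ∃ m, (n : ℝ≥0) < mix d (prefixOf X m)} =
      ⋃ m, {X | prefixOf X m ∈ {τ | (n : ℝ≥0) < mix d τ}} := by ext; simp
  simp only [this]
  exact isOpen_iUnion fun m => (isClopen_prefixOf _ m).isOpen

end

end Randomness

theorem mainTheorem1 :
    Randomness.LowPair Randomness.W2R Randomness.MLR = Randomness.Low Randomness.MLR ∧
    Randomness.LowPair Randomness.W2R Randomness.CR =
      Randomness.LowPair Randomness.MLR Randomness.CR ∧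
    Randomness.LowPair Randomness.W2R Randomness.SR =
      Randomness.LowPair Randomness.MLR Randomness.SR := by
  have hW := Randomness.W2R_subset_MLR ∅
  refine ⟨?_, ?_, ?_⟩ <;> ext A
  · refine ⟨fun h => Set.Subset.antisymm (Randomness.MLR_antitone (Set.empty_subset _)) ?_,
      fun h => hW.trans (Eq.ge h)⟩
    exact Randomness.MLR_subset_MLR_of_W2R_subset (Randomness.totalOracles_oracle A) h
  · exact ⟨fun h => Randomness.MLR_subset_CR_of_W2R_subset h, fun h => hW.trans h⟩
  · exact ⟨fun h => Randomness.MLR_subset_SR_of_W2R_subset (Randomness.totalOracles_oracle A) h,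
      fun h => hW.trans h⟩
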